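/- Let $p:\{0,1,2,\dots\}\to\mathbb R$ satisfy $|p(\delta)|\le M$ for all $\delta$, fix a buffer position $b\in\{0,1,2,\dots\}$, and let $T_0,T_1,\dots$ be i.i.d. integer-valued transmission times with $T_i\ge 1$ and $\mathbb E[T_i]<\infty$. Feature $i$ is sent at time $S_i$ and delivered at $D_i=S_i+T_i$, where $S_0=0$ and $S_{i+1}\ge D_i$; when sent, it is $b$ slots old. The age of information is $\Delta(t)=t-\max\{S_i-b: D_i\le t\}$ for $t\ge D_0$ and $\Delta(t)=\Delta(0)+t$ for $t<D_0$, where $\Delta(0)$ is a given constant. A schedule $(S_1,S_2,\dots)$ is causal if each $S_{i+1}$ is a finite time determined by the information $\mathcal F_i$ available to the scheduler after the $i$-th delivery; here $\mathcal F_0\subseteq\mathcal F_1\subseteq\cdots$, $T_i$ is $\mathcal F_i$-measurable, and $T_{i+1}$ is independent of $\mathcal F_i$. Let $$\bar p_{b,\mathrm{opt}}=\inf_{(S_1,S_2,\dots)\ \mathrm{causal}}\ \limsup_{n\to\infty}\frac1n\,\mathbb E\Big[\sum_{t=0}^{n-1}p(\Delta(t))\Big],\qquad \gamma(\delta)=\inf_{\tau\in\{1,2,\dots\}}\frac1\tau\sum_{k=0}^{\tau-1}\mathbb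 E[p(\delta+k+T_1)].$$ For $\beta\in\mathbb R$ let $S_0(\beta)=0$, $D_i(\beta)=S_i(\beta)+T_i$ and $$S_{i+1}(\beta)=\min\{t\ge D_i(\beta):\ \gamma(t-S_i(\beta)+b)\ge\beta\}.$$ Assume that sending is worthwhile in the following sense: there is a waiting rule $w:\{0,1,2,\dots\}\to\{0,1,2,\dots\}$ with $\mathbb E[w(T_0+b)]<\infty$ and $$\frac{\mathbb E\big[\sum_{k=0}^{w(T_0+b)+T_1-1}p(T_0+b+k)\big]}{\mathbb E[w(T_0+b)+T_1]}\ \le\ \liminf_{n\to\infty}\frac1n\sum_{\delta=0}^{n-1}p(\delta).$$ Then there is a $\beta_b\in\mathbb R$ such that, for every $i\ge 0$, $\beta_b$ is the unique root of $$\mathbb E\Big[\sum_{t=D_i(\beta)}^{D_{i+1}(\beta)-1}p(\Delta(t))\Big]-\beta\,\mathbb E\big[D_{i+1}(\beta)-D_i(\beta)\big]=0,$$ where $\Delta$ is the age under the schedule $(S_1(\beta),S_2(\beta),\dots)$ and where $\beta$ being a root includes that the minima defining this schedule exist almost surely and that $\mathbb E[D_{i+1}(\beta)-D_i(\beta)]<\infty$.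 The schedule $(S_1(\beta_b),S_2(\beta_b),\dots)$ is causal and attains the infimum $\bar p_{b,\mathrm{opt}}$, and, for every $i\ge 0$, $$\beta_b=\bar p_{b,\mathrm{opt}}=\frac{\mathbb E\big[\sum_{t=D_i(\beta_b)}^{D_{i+1}(\beta_b)-1}p(\Delta(t))\big]}{\mathbb E\big[D_{i+1}(\beta_b)-D_i(\beta_b)\big]}.$$ -/

import Mathlib

open MeasureTheory ProbabilityTheory Filter

namespace BufferScheduling

noncomputable section

variable {Ω : Type*} [MeasurableSpace Ω]

/-- Delivery time `D_i = S_i + T_i` of feature `i`. -/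
def delivery (T S : ℕ → Ω → ℕ) (i : ℕ) (ω : Ω) : ℕ := S i ω + T i ω

open Classical in
/-- Age of information `Δ(t) = t - max {S_i - b : D_i ≤ t}`, that is, the least of the ages
`t - S_i + b` of the features delivered by time `t` (here `S_i ≤ D_i ≤ t`, so the subtraction is
exact). Before the first delivery the age grows linearly from its initial value `Δ(0) = Δ₀`. -/
def age (T : ℕ → Ω → ℕ) (b Δ₀ : ℕ) (S : ℕ → Ω → ℕ) (t : ℕ) (ω : Ω) : ℕ :=
  if ∃ i, delivery T S i ω ≤ t then
    sInf {a : ℕ | ∃ i, delivery T S i ω ≤ t ∧ a = t - S i ω + b}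
  else Δ₀ + t

/-- The causal sending schedules `S = (S_0, S_1, …)` with `S_0 = 0`: the sending time `S_{i+1}` is
chosen from the information `ℱ i` that the scheduler has after the `i`-th delivery, and no feature
is sent before the previous one has been delivered. -/
structure IsCausal (μ : Measure Ω) (ℱ : Filtration ℕ (inferInstance : MeasurableSpace Ω))
    (T S : ℕ → Ω → ℕ) : Prop where
  zero : ∀ ω, S 0 ω = 0
  adapted : ∀ i, Measurable[ℱ i] (S (i + 1))
  feasible : ∀ᵐ ω ∂μ, ∀ i, delivery T S i ω ≤ S (i + 1) ω

/-- The long-run average cost `limsup_n (1/n) E[∑_{t<n} p(Δ(t))]` of a schedule. -/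
def avgCost (μ : Measure Ω) (p : ℕ → ℝ) (T : ℕ → Ω → ℕ) (b Δ₀ : ℕ) (S : ℕ → Ω → ℕ) : ℝ :=
  limsup (fun n : ℕ => (1 / (n : ℝ)) *
    ∫ ω, ∑ t ∈ Finset.range n, p (age T b Δ₀ S t ω) ∂μ) atTop

/-- The optimal average cost over all causal schedules. -/
def optCost (μ : Measure Ω) (ℱ : Filtration ℕ (inferInstance : MeasurableSpace Ω))
    (p : ℕ → ℝ) (T : ℕ → Ω → ℕ) (b Δ₀ : ℕ) : ℝ :=
  sInf (avgCost μ p T b Δ₀ '' {S | IsCausal μ ℱ T S})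

/-- The index `γ(δ) = inf_{τ ≥ 1} (1/τ) ∑_{k<τ} E[p(δ + k + T_1)]`. -/
def gammaIndex (μ : Measure Ω) (p : ℕ → ℝ) (T : ℕ → Ω → ℕ) (δ : ℕ) : ℝ :=
  ⨅ τ : ℕ+, (1 / ((τ : ℕ) : ℝ)) *
    ∑ k ∈ Finset.range (τ : ℕ), ∫ ω, p (δ + k + T 1 ω) ∂μ

/-- The index-threshold schedule: `S_0 = 0` and
`S_{i+1} = min {t ≥ D_i : γ(Δ(t)) ≥ β}`, where `Δ(t) = t - S_i + b`. -/
def thresholdSend (μ : Measure Ω) (p : ℕ → ℝ) (T : ℕ → Ω → ℕ) (b : ℕ) (β : ℝ) :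
    ℕ → Ω → ℕ
  | 0, _ => 0
  | i + 1, ω => sInf {t : ℕ | thresholdSend μ p T b β i ω + T i ω ≤ t ∧
      β ≤ gammaIndex μ p T (t - thresholdSend μ p T b β i ω + b)}

/-- The minima that define the index-threshold schedule exist, almost surely. -/
def ThresholdWellDefined (μ : Measure Ω) (p : ℕ → ℝ) (T : ℕ → Ω → ℕ) (b : ℕ) (β : ℝ) : Prop :=
  ∀ᵐ ω ∂μ, ∀ i, ∃ t : ℕ, thresholdSend μ p T b β i ω + T i ω ≤ t ∧
    β ≤ gammaIndex μ p T (t - thresholdSend μ p T b β i ω + b)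

/-- `D_{i+1} - D_i`, as a real number. -/
def cycleLength (T S : ℕ → Ω → ℕ) (i : ℕ) (ω : Ω) : ℝ :=
  (delivery T S (i + 1) ω : ℝ) - (delivery T S i ω : ℝ)

/-- `∑_{t = D_i}^{D_{i+1} - 1} p(Δ(t))`. -/
def cycleCost (p : ℕ → ℝ) (T : ℕ → Ω → ℕ) (b Δ₀ : ℕ) (S : ℕ → Ω → ℕ) (i : ℕ) (ω : Ω) : ℝ :=
  ∑ t ∈ Finset.Ico (delivery T S i ω) (delivery T S (i + 1) ω), p (age T b Δ₀ S t ω)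

/-- `β` is a root of the equation
`E[∑_{t=D_i(β)}^{D_{i+1}(β)-1} p(Δ(t))] - β E[D_{i+1}(β) - D_i(β)] = 0`, which includes that the
schedule is defined and that the expectations are finite (for bounded `p` the first one is finite
as soon as the second one is). -/
structure IsThresholdRoot (μ : Measure Ω) (p : ℕ → ℝ) (T : ℕ → Ω → ℕ) (b Δ₀ : ℕ) (i : ℕ)
    (β : ℝ) : Prop where
  wellDefined : ThresholdWellDefined μ p T b β
  integrable : Integrable (cycleLength T (thresholdSend μ p T b β) i) μ
  equation : (∫ ω, cycleCost p T b Δ₀ (thresholdSend μ p T b β) i ω ∂μ)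
    - β * (∫ ω, cycleLength T (thresholdSend μ p T b β) i ω ∂μ) = 0

/-- The long-run average penalty when nothing is sent any more:
`liminf_n (1/n) ∑_{δ<n} p(δ)`. -/
def staleCost (p : ℕ → ℝ) : ℝ :=
  liminf (fun n : ℕ => (1 / (n : ℝ)) * ∑ δ ∈ Finset.range n, p δ) atTop

/-- Sending is worthwhile: for some waiting rule `w` with finite mean (wait `w(δ)` slots when the
age is `δ` at a delivery), the ratio of expected cost to expected length of an inter-delivery
interval is at most the long-run average penalty when nothing is sent any more. -/
def SendingWorthwhile (μ : Measure Ω) (p : ℕ → ℝ) (T : ℕ → Ω → ℕ) (b : ℕ) : Prop :=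
  ∃ w : ℕ → ℕ, Integrable (fun ω => (w (T 0 ω + b) : ℝ)) μ ∧
    (∫ ω, ∑ k ∈ Finset.range (w (T 0 ω + b) + T 1 ω), p (T 0 ω + b + k) ∂μ)
        / (∫ ω, ((w (T 0 ω + b) : ℝ) + (T 1 ω : ℝ)) ∂μ)
      ≤ staleCost p

end

end BufferScheduling

/-! Write Q for `excess` and V for `meanExcess` at level β. While the age grows from x to x + k, the
cost in excess of β is Q(x + k) - Q(x), and V(n) is the mean of Q at the delivery of a feature sent
at age n. Since V(δ + τ) - V(δ) is the sum in the definition of γ minus τβ, the condition γ(δ) ≥ β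
says that V never falls below V(δ) after δ (`le_gammaIndex_iff`). The first such age is a global
minimiser of V from the current age on, so the index rule solves a one-cycle stopping problem
exactly.

A stationary waiting rule has the cycle gain E[V(age at sending)] - E[Q(T + b)], which is its cost
minus β times its length (`integral_cycle`). The optimal β is the infimum of the ratios cost/length.
It is attained (`exists_optimal_rule`): below the stale cost, Q grows linearly and minimising rules
exist with uniformly bounded mean length; otherwise the rule given by the hypothesis already attains
it. A rule with least gain minimises V pointwise almost surely, so the index rule has gain zero as
well and β is a root. Any root arises in this way, and gains decrease in β with slope at least 1 in
absolute value, whence uniqueness.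

For an arbitrary causal schedule the excess cost up to n telescopes to a boundary term plus the
drops of Q at deliveries. Given the past, a drop has mean V(age at sending) - E[Q(T + b)]; V there
is at least its minimum from the age at the preceding delivery on, and this minimum has mean E[Q(T +
b)] because the gain is zero. The end effects are of the order of the expected maximum of n + 1
identically distributed integrable periods, which is o(n). Hence no causal schedule beats β, and a
schedule following the index rule attains it. -/

set_option linter.unusedSectionVars false

/-! ### Excess functions and the index rule as a stopping problem -/

namespace BufferScheduling

variable {Ω : Type*} [MeasurableSpace Ω]

/-- The standing assumptions on penalty, transmission times and information. -/
structure IsModel (μ : Measure Ω) (ℱ : Filtration ℕ (inferInstance : MeasurableSpace Ω))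
    (p : ℕ → ℝ) (M : ℝ) (T : ℕ → Ω → ℕ) : Prop where
  bounded : ∀ δ, |p δ| ≤ M
  pos : ∀ i ω, 1 ≤ T i ω
  ident : ∀ i, IdentDistrib (T i) (T 0) μ μ
  integrable : Integrable (fun ω => (T 0 ω : ℝ)) μ
  past : ∀ i, Measurable[ℱ i] (T i)
  future : ∀ i, Indep (ℱ i) (MeasurableSpace.comap (T (i + 1)) inferInstance) μ

/-- The accumulated penalty in excess of `β` over the ages `0, …, n - 1`. -/
noncomputable def excess (p : ℕ → ℝ) (β : ℝ) (n : ℕ) : ℝ := ∑ k ∈ Finset.range n, (p k - β)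

/-- The mean of `excess` at the age at which a feature sent at age `n` is delivered. -/
noncomputable def meanExcess (μ : Measure Ω) (p : ℕ → ℝ) (T : ℕ → Ω → ℕ) (β : ℝ) (n : ℕ) : ℝ :=
  ∫ ω, excess p β (n + T 0 ω) ∂μ

/-- The waiting time prescribed by the index rule at age `a`. -/
noncomputable def indexWait (μ : Measure Ω) (p : ℕ → ℝ) (T : ℕ → Ω → ℕ) (β : ℝ) (a : ℕ) : ℕ :=
  sInf {k : ℕ | β ≤ gammaIndex μ p T (a + k)}

section Excess

variable {p : ℕ → ℝ} {M : ℝ}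

lemma excess_add (p : ℕ → ℝ) (β : ℝ) (m k : ℕ) :
    excess p β (m + k) = excess p β m + ∑ j ∈ Finset.range k, (p (m + j) - β) := by
  simp only [excess, Finset.sum_range_add]

lemma excess_eq_sum_sub (p : ℕ → ℝ) (β : ℝ) (n : ℕ) :
    excess p β n = (∑ k ∈ Finset.range n, p k) - n * β := by
  simp [excess, Finset.sum_sub_distrib]

lemma excess_change (p : ℕ → ℝ) (β β' : ℝ) (n : ℕ) :
    excess p β n = excess p β' n + (β' - β) * n := by
  rw [excess_eq_sum_sub, excess_eq_sum_sub]; ring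

lemma abs_excess_add_sub_le (hp : ∀ δ, |p δ| ≤ M) (β : ℝ) (m k : ℕ) :
    |excess p β (m + k) - excess p β m| ≤ (M + |β|) * k := by
  rw [excess_add, add_sub_cancel_left]
  refine (Finset.abs_sum_le_sum_abs _ _).trans ?_
  refine (Finset.sum_le_card_nsmul _ _ (M + |β|) fun j _ => ?_).trans_eq ?_
  · exact (abs_sub _ _).trans (by gcongr; exact hp _)
  · simp only [Finset.card_range, nsmul_eq_mul, mul_comm]

lemma abs_excess_le (hp : ∀ δ, |p δ| ≤ M) (β : ℝ) (n : ℕ) :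
    |excess p β n| ≤ (M + |β|) * n := by
  have h := abs_excess_add_sub_le hp β 0 n
  simpa [excess] using h

lemma lipschitz_nonneg (hp : ∀ δ, |p δ| ≤ M) (β : ℝ) : 0 ≤ M + |β| :=
  add_nonneg ((abs_nonneg _).trans (hp 0)) (abs_nonneg _)

lemma integrable_excess {μ : Measure Ω} (hp : ∀ δ, |p δ| ≤ M) (β : ℝ)
    {Y : Ω → ℕ} (hY : Measurable Y) (hi : Integrable (fun ω => (Y ω : ℝ)) μ) :
    Integrable (fun ω => excess p β (Y ω)) μ := by
  refine (hi.const_mul (M + |β|)).mono' ?_ (Eventually.of_forall fun ω => ?_)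
  · exact ((Measurable.of_discrete (f := excess p β)).comp hY).aestronglyMeasurable
  · exact abs_excess_le hp β _

end Excess

/-- A first point from which on a sequence stays above its value is a minimiser. -/
lemma le_of_first_tail_minimum {f : ℕ → ℝ} {w : ℕ} (hw : ∀ k, f w ≤ f (w + k))
    (hfirst : ∀ v < w, ∃ k, f (v + k) < f v) (k : ℕ) : f w ≤ f k := by
  by_cases hk : w ≤ k
  · obtain ⟨j, rfl⟩ := Nat.exists_eq_add_of_le hk
    exact hw j
  -- From a point before `w` one can move right to a strictly smaller value; the distance to `w`
  -- shrinks until `w` is reached or passed.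
  · induction h : w - k using Nat.strong_induction_on generalizing k with
    | _ n ih =>
      obtain ⟨j, hj⟩ := hfirst k (by omega)
      have hj0 : j ≠ 0 := by rintro rfl; simp at hj
      by_cases hkj : w ≤ k + j
      · obtain ⟨i, hi⟩ := Nat.exists_eq_add_of_le hkj
        exact (hi ▸ hw i).trans hj.le
      · exact (ih (w - (k + j)) (by omega) (k + j) hkj rfl).trans hj.le

section Model

variable {μ : Measure Ω} [IsProbabilityMeasure μ]
  {ℱ : Filtration ℕ (inferInstance : MeasurableSpace Ω)} {p : ℕ → ℝ} {M : ℝ} {T : ℕ → Ω → ℕ}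

namespace IsModel

lemma measurable (h : IsModel μ ℱ p M T) (i : ℕ) : Measurable (T i) :=
  (h.past i).mono (ℱ.le i) le_rfl

lemma identComp (h : IsModel μ ℱ p M T) {E : Type*} [MeasurableSpace E] (f : ℕ → E) (i : ℕ) :
    IdentDistrib (fun ω => f (T i ω)) (fun ω => f (T 0 ω)) μ μ :=
  (h.ident i).comp (Measurable.of_discrete (f := f))

lemma integral_comp (h : IsModel μ ℱ p M T) (f : ℕ → ℝ) (i : ℕ) :
    ∫ ω, f (T i ω) ∂μ = ∫ ω, f (T 0 ω) ∂μ :=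
  (h.identComp f i).integral_eq

lemma integrable_comp (h : IsModel μ ℱ p M T) {f : ℕ → ℝ}
    (hf : Integrable (fun ω => f (T 0 ω)) μ) (i : ℕ) : Integrable (fun ω => f (T i ω)) μ :=
  (h.identComp f i).integrable_iff.2 hf

lemma ae_comp (h : IsModel μ ℱ p M T) {P : ℕ → Prop} (hP : ∀ᵐ ω ∂μ, P (T 0 ω)) (i : ℕ) :
    ∀ᵐ ω ∂μ, P (T i ω) :=
  (h.ident i).symm.ae_snd (p := P) (MeasurableSet.of_discrete (s := {n | P n})) hP

lemma integrable_time (h : IsModel μ ℱ p M T) (i : ℕ) : Integrable (fun ω => (T i ω : ℝ)) μ :=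
  h.integrable_comp (f := fun n => (n : ℝ)) h.integrable i

/-- Integrate a function of past information and the next transmission time by first averaging
over the latter. -/
lemma integral_freeze (h : IsModel μ ℱ p M T) {E : Type*} [MeasurableSpace E] [Countable E]
    [MeasurableSingletonClass E] (i : ℕ) {X : Ω → E} (hX : Measurable[ℱ i] X) (F : E → ℕ → ℝ)
    (hF : Integrable (fun ω => F (X ω) (T (i + 1) ω)) μ) :
    ∫ ω, F (X ω) (T (i + 1) ω) ∂μ = ∫ ω, (∫ ω', F (X ω) (T 0 ω') ∂μ) ∂μ := by
  have hXm : Measurable X := hX.mono (ℱ.le i) le_rfl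
  have hTm := h.measurable (i + 1)
  have hind : IndepFun X (T (i + 1)) μ := by
    rw [IndepFun_iff_Indep]
    exact indep_of_indep_of_le_left (h.future i) hX.comap_le
  have hmap := (indepFun_iff_map_prod_eq_prod_map_map hXm.aemeasurable hTm.aemeasurable).1 hind
  have hFm : Measurable (Function.uncurry F) := Measurable.of_discrete
  have hprod : Integrable (Function.uncurry F) ((μ.map X).prod (μ.map (T (i + 1)))) := by
    rw [← hmap]
    exact (integrable_map_measure hFm.aestronglyMeasurable (hXm.prodMk hTm).aemeasurable).2 hF
  have := Measure.isProbabilityMeasure_map (μ := μ) hXm.aemeasurable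
  have := Measure.isProbabilityMeasure_map (μ := μ) hTm.aemeasurable
  calc ∫ ω, F (X ω) (T (i + 1) ω) ∂μ
      = ∫ z, Function.uncurry F z ∂(μ.map fun ω => (X ω, T (i + 1) ω)) := by
        rw [integral_map (hXm.prodMk hTm).aemeasurable hFm.aestronglyMeasurable]; rfl
    _ = ∫ x, ∫ t, F x t ∂(μ.map (T (i + 1))) ∂(μ.map X) := by
        rw [hmap, integral_prod _ hprod]; rfl
    _ = ∫ x, ∫ ω', F x (T 0 ω') ∂μ ∂(μ.map X) := by
        refine integral_congr_ae (Eventually.of_forall fun x => ?_)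
        change ∫ t, F x t ∂(μ.map (T (i + 1))) = ∫ ω', F x (T 0 ω') ∂μ
        rw [integral_map hTm.aemeasurable Measurable.of_discrete.aestronglyMeasurable]
        exact h.integral_comp (F x) (i + 1)
    _ = _ := integral_map hXm.aemeasurable Measurable.of_discrete.aestronglyMeasurable

lemma integrable_penalty (h : IsModel μ ℱ p M T) {Y : Ω → ℕ} (hY : Measurable Y) :
    Integrable (fun ω => p (Y ω)) μ :=
  Integrable.of_bound
    ((Measurable.of_discrete (f := p)).comp hY).aestronglyMeasurable M
    (Eventually.of_forall fun _ => h.bounded _)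

lemma integrable_excess_add (h : IsModel μ ℱ p M T) (β : ℝ) (n i : ℕ) :
    Integrable (fun ω => excess p β (n + T i ω)) μ := by
  refine integrable_excess h.bounded β (measurable_const.add (h.measurable i)) ?_
  simpa using (integrable_const (n : ℝ)).add (h.integrable_time i)

lemma meanExcess_add (h : IsModel μ ℱ p M T) (β : ℝ) (n τ : ℕ) :
    meanExcess μ p T β (n + τ) = meanExcess μ p T β n +
      ((∑ k ∈ Finset.range τ, ∫ ω, p (n + k + T 1 ω) ∂μ) - τ * β) := by
  induction τ with
  | zero => simp
  | succ τ ih =>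
    have hstep : meanExcess μ p T β (n + (τ + 1)) =
        meanExcess μ p T β (n + τ) + (∫ ω, p (n + τ + T 1 ω) ∂μ - β) := by
      rw [h.integral_comp (fun t => p (n + τ + t)) 1]
      unfold meanExcess
      have hi : Integrable (fun ω => p (n + τ + T 0 ω)) μ :=
        h.integrable_penalty (measurable_const.add (h.measurable 0))
      have hsub : ∫ ω, p (n + τ + T 0 ω) ∂μ - β = ∫ ω, (p (n + τ + T 0 ω) - β) ∂μ := by
        rw [integral_sub hi (integrable_const _)]; simp
      have hi' : Integrable (fun ω => p (n + τ + T 0 ω) - β) μ := hi.sub (integrable_const _)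
      rw [hsub, ← integral_add (h.integrable_excess_add β _ 0) hi']
      refine integral_congr_ae (Eventually.of_forall fun ω => ?_)
      have := excess_add p β (n + τ + T 0 ω) 1
      simp only [Finset.range_one, Finset.sum_singleton, add_zero] at this
      simp only
      rw [← this]; congr 1; ring
    rw [hstep, ih, Finset.sum_range_succ]; push_cast; ring

/-- Multiplying the average over τ slots by τ turns it into the increment of `meanExcess` plus τβ,
by `meanExcess_add`. Boundedness of `p` keeps the infimum over τ a genuine one. -/
lemma le_gammaIndex_iff (h : IsModel μ ℱ p M T) (β : ℝ) (δ : ℕ) :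
    β ≤ gammaIndex μ p T δ ↔ ∀ k, meanExcess μ p T β δ ≤ meanExcess μ p T β (δ + k) := by
  have hbdd : BddBelow (Set.range fun τ : ℕ+ => (1 / ((τ : ℕ) : ℝ)) *
      ∑ k ∈ Finset.range (τ : ℕ), ∫ ω, p (δ + k + T 1 ω) ∂μ) := by
    refine ⟨-M, ?_⟩
    rintro _ ⟨τ, rfl⟩
    have hτ : (0 : ℝ) < ((τ : ℕ) : ℝ) := by exact_mod_cast τ.pos
    have : (Finset.range (τ : ℕ)).card • (-M) ≤
        ∑ k ∈ Finset.range (τ : ℕ), ∫ ω, p (δ + k + T 1 ω) ∂μ := by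
      refine Finset.card_nsmul_le_sum _ _ _ fun k _ => ?_
      have hm := integral_mono (integrable_const (-M))
        (h.integrable_penalty (measurable_const.add (h.measurable 1)))
        (fun ω => (abs_le.1 (h.bounded (δ + k + T 1 ω))).1)
      simpa using hm
    simp only [Finset.card_range, nsmul_eq_mul] at this
    simp only
    rw [one_div, inv_mul_eq_div, le_div_iff₀ hτ]
    linarith
  unfold gammaIndex
  rw [le_ciInf_iff hbdd]
  have key : ∀ τ : ℕ+, (β ≤ (1 / ((τ : ℕ) : ℝ)) *
      ∑ k ∈ Finset.range (τ : ℕ), ∫ ω, p (δ + k + T 1 ω) ∂μ) ↔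
      meanExcess μ p T β δ ≤ meanExcess μ p T β (δ + τ) := by
    intro τ
    have hτ : (0 : ℝ) < ((τ : ℕ) : ℝ) := by exact_mod_cast τ.pos
    rw [h.meanExcess_add β δ τ, one_div, inv_mul_eq_div, le_div_iff₀ hτ]
    constructor <;> intro <;> linarith
  constructor
  · intro H k
    rcases Nat.eq_zero_or_pos k with rfl | hk
    · simp
    · exact (key ⟨k, hk⟩).1 (H ⟨k, hk⟩)
  · exact fun H τ => (key τ).2 (H τ)

/-- Every age before the chosen one fails the tail-minimum test of `le_gammaIndex_iff`, so
`le_of_first_tail_minimum` applies. -/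
lemma meanExcess_indexWait_le (h : IsModel μ ℱ p M T) {β : ℝ} {a : ℕ}
    (ha : ∃ k, β ≤ gammaIndex μ p T (a + k)) (k : ℕ) :
    meanExcess μ p T β (a + indexWait μ p T β a) ≤ meanExcess μ p T β (a + k) := by
  have hmem : β ≤ gammaIndex μ p T (a + indexWait μ p T β a) := Nat.sInf_mem ha
  refine le_of_first_tail_minimum (f := fun k => meanExcess μ p T β (a + k))
    (fun k => ?_) (fun v hv => ?_) k
  · simpa [add_assoc] using (h.le_gammaIndex_iff β _).1 hmem k
  · have : ¬ β ≤ gammaIndex μ p T (a + v) := Nat.notMem_of_lt_sInf hv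
    rw [h.le_gammaIndex_iff] at this
    push Not at this
    simpa [add_assoc] using this

/-- A global minimiser is in particular a tail minimum. This is how existence and integrability pass
from any minimising rule to the index rule. -/
lemma indexWait_of_minimum (h : IsModel μ ℱ p M T) {β : ℝ} {a w : ℕ}
    (hw : ∀ k, meanExcess μ p T β (a + w) ≤ meanExcess μ p T β (a + k)) :
    (∃ k, β ≤ gammaIndex μ p T (a + k)) ∧ indexWait μ p T β a ≤ w := by
  have : β ≤ gammaIndex μ p T (a + w) :=
    (h.le_gammaIndex_iff β _).2 fun k => by simpa [add_assoc] using hw (w + k)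
  exact ⟨⟨w, this⟩, Nat.sInf_le this⟩

lemma abs_meanExcess_sub_excess_le (h : IsModel μ ℱ p M T) (β : ℝ) (n : ℕ) :
    |meanExcess μ p T β n - excess p β n| ≤ (M + |β|) * ∫ ω, (T 0 ω : ℝ) ∂μ := by
  have : meanExcess μ p T β n - excess p β n =
      ∫ ω, (excess p β (n + T 0 ω) - excess p β n) ∂μ := by
    rw [integral_sub (h.integrable_excess_add β n 0) (integrable_const _)]; simp [meanExcess]
  rw [this, ← integral_const_mul]
  refine (abs_integral_le_integral_abs).trans ?_
  exact integral_mono ((h.integrable_excess_add β n 0).sub (integrable_const _)).abs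
    (h.integrable.const_mul _) fun ω => abs_excess_add_sub_le h.bounded β n (T 0 ω)

lemma abs_meanExcess_le (h : IsModel μ ℱ p M T) (β : ℝ) (n : ℕ) :
    |meanExcess μ p T β n| ≤ (M + |β|) * (n + ∫ ω, (T 0 ω : ℝ) ∂μ) := by
  have h1 := h.abs_meanExcess_sub_excess_le β n
  have h2 := abs_excess_le h.bounded β n
  rw [abs_le] at *
  constructor <;> linarith

lemma integrable_meanExcess (h : IsModel μ ℱ p M T) (β : ℝ)
    {Y : Ω → ℕ} (hY : Measurable Y) (hi : Integrable (fun ω => (Y ω : ℝ)) μ) :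
    Integrable (fun ω => meanExcess μ p T β (Y ω)) μ := by
  refine ((hi.add (integrable_const (∫ ω, (T 0 ω : ℝ) ∂μ))).const_mul (M + |β|)).mono' ?_
    (Eventually.of_forall fun ω => ?_)
  · exact ((Measurable.of_discrete (f := meanExcess μ p T β)).comp hY).aestronglyMeasurable
  · exact h.abs_meanExcess_le β _

lemma meanExcess_change (h : IsModel μ ℱ p M T) (β β' : ℝ) (n : ℕ) :
    meanExcess μ p T β n = meanExcess μ p T β' n + (β' - β) * (n + ∫ ω, (T 0 ω : ℝ) ∂μ) := by
  have hi : Integrable (fun ω => ((n + T 0 ω : ℕ) : ℝ)) μ := by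
    simpa using (integrable_const (n : ℝ)).add h.integrable
  have : (n + ∫ ω, (T 0 ω : ℝ) ∂μ) = ∫ ω, ((n + T 0 ω : ℕ) : ℝ) ∂μ := by
    simp only [Nat.cast_add]
    rw [integral_add (integrable_const _) h.integrable]; simp
  rw [this, ← integral_const_mul]
  unfold meanExcess
  rw [← integral_add (h.integrable_excess_add β' n 0) (hi.const_mul _)]
  exact integral_congr_ae (Eventually.of_forall fun ω => excess_change p β β' _)

end IsModel

end Model

end BufferScheduling

/-! ### Sample paths: the age process and its telescoping cost -/

namespace BufferScheduling

variable {Ω : Type*}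

/-- The age at the moment feature `i` is sent. -/
def sendAge (b Δ₀ : ℕ) (S : ℕ → Ω → ℕ) : ℕ → Ω → ℕ
  | 0, _ => Δ₀
  | i + 1, ω => S (i + 1) ω - S i ω + b

/-- The drop of `excess` at the delivery of feature `i`. -/
noncomputable def excessDrop (p : ℕ → ℝ) (β : ℝ) (T : ℕ → Ω → ℕ) (b Δ₀ : ℕ) (S : ℕ → Ω → ℕ)
    (i : ℕ) (ω : Ω) : ℝ :=
  excess p β (sendAge b Δ₀ S i ω + T i ω) - excess p β (T i ω + b)

/-- A feasible sample path of sending and transmission times. -/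
structure IsFeasibleAt (T S : ℕ → Ω → ℕ) (ω : Ω) : Prop where
  zero : S 0 ω = 0
  pos : ∀ i, 1 ≤ T i ω
  feasible : ∀ i, S i ω + T i ω ≤ S (i + 1) ω

namespace IsFeasibleAt

variable {T S : ℕ → Ω → ℕ} {ω : Ω} {b Δ₀ : ℕ}

lemma strictMono (h : IsFeasibleAt T S ω) : StrictMono (fun i => S i ω) :=
  strictMono_nat_of_lt_succ fun i => by
    have := h.feasible i
    have := h.pos i
    omega

lemma delivery_strictMono (h : IsFeasibleAt T S ω) : StrictMono (fun i => delivery T S i ω) :=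
  strictMono_nat_of_lt_succ fun i => by
    have := h.feasible i
    have := h.pos (i + 1)
    simp only [delivery]
    omega

lemma le_send (h : IsFeasibleAt T S ω) (i : ℕ) : i ≤ S i ω := h.strictMono.id_le i

/-- Sending and delivery times both increase, so the latest delivered feature is the freshest. -/
lemma age_of_delivered (h : IsFeasibleAt T S ω) {N t : ℕ} (h1 : delivery T S N ω ≤ t)
    (h2 : t < delivery T S (N + 1) ω) : age T b Δ₀ S t ω = t - S N ω + b := by
  rw [age, if_pos ⟨N, h1⟩]
  apply le_antisymm
  · exact Nat.sInf_le ⟨N, h1, rfl⟩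
  · refine le_csInf ⟨_, N, h1, rfl⟩ ?_
    rintro a ⟨i, hi, rfl⟩
    have hiN : i ≤ N := by
      by_contra hcon
      have := h.delivery_strictMono.monotone (show N + 1 ≤ i by omega)
      omega
    have := h.strictMono.monotone hiN
    omega

lemma age_of_not_delivered (h : IsFeasibleAt T S ω) {t : ℕ} (h1 : t < delivery T S 0 ω) :
    age T b Δ₀ S t ω = Δ₀ + t := by
  rw [age, if_neg]
  rintro ⟨i, hi⟩
  have := h.delivery_strictMono.monotone (Nat.zero_le i)
  omega

lemma age_in_service (h : IsFeasibleAt T S ω) {N j : ℕ} (hj : j < T N ω) :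
    age T b Δ₀ S (S N ω + j) ω = sendAge b Δ₀ S N ω + j := by
  cases N with
  | zero =>
    rw [h.age_of_not_delivered (by simp only [delivery]; omega), h.zero, sendAge]; omega
  | succ N =>
    have := h.feasible N
    rw [h.age_of_delivered (N := N) (by simp only [delivery]; omega)
      (by simp only [delivery]; omega), sendAge]
    omega

/-- No delivery interrupts the growth of the age, so one formula covers both the waiting time and
the next transmission. -/
lemma age_idle (h : IsFeasibleAt T S ω) {N j : ℕ}
    (hj : S N ω + T N ω + j < S (N + 1) ω + T (N + 1) ω) :
    age T b Δ₀ S (S N ω + T N ω + j) ω = T N ω + b + j := by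
  rw [h.age_of_delivered (N := N) (by simp only [delivery]; omega)
      (by simp only [delivery]; omega)]
  omega

lemma sum_range_add_of_age (p : ℕ → ℝ) (β : ℝ) {s x k : ℕ}
    (hage : ∀ j < k, age T b Δ₀ S (s + j) ω = x + j) :
    ∑ t ∈ Finset.range (s + k), (p (age T b Δ₀ S t ω) - β) =
      ∑ t ∈ Finset.range s, (p (age T b Δ₀ S t ω) - β) +
        (excess p β (x + k) - excess p β x) := by
  rw [Finset.sum_range_add, excess_add, add_sub_cancel_left]
  congr 1
  exact Finset.sum_congr rfl fun j hj => by rw [hage j (Finset.mem_range.1 hj)]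

lemma sum_range_delivery (h : IsFeasibleAt T S ω) (p : ℕ → ℝ) (β : ℝ) {N k : ℕ}
    (hk : k ≤ T N ω) :
    ∑ t ∈ Finset.range (S N ω + k), (p (age T b Δ₀ S t ω) - β) =
      ∑ t ∈ Finset.range (S N ω), (p (age T b Δ₀ S t ω) - β) +
        (excess p β (sendAge b Δ₀ S N ω + k) - excess p β (sendAge b Δ₀ S N ω)) :=
  sum_range_add_of_age p β fun _ hj => h.age_in_service (by omega)

lemma sum_range_idle (h : IsFeasibleAt T S ω) (p : ℕ → ℝ) (β : ℝ) {N k : ℕ}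
    (hk : S N ω + T N ω + k ≤ S (N + 1) ω) :
    ∑ t ∈ Finset.range (S N ω + T N ω + k), (p (age T b Δ₀ S t ω) - β) =
      ∑ t ∈ Finset.range (S N ω), (p (age T b Δ₀ S t ω) - β) +
        excessDrop p β T b Δ₀ S N ω + excess p β (T N ω + b + k) -
          excess p β (sendAge b Δ₀ S N ω) := by
  rw [sum_range_add_of_age p β (x := T N ω + b)
    (fun j hj => h.age_idle (by have := h.pos (N + 1); omega)),
    h.sum_range_delivery p β le_rfl, excessDrop]
  ring

/-- Between deliveries the cost is an increment of `excess` along the age. Delivery `i` moves the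
age from `sendAge + T i` to `T i + b`, and `excessDrop` compensates for this jump. -/
lemma sum_range_send (h : IsFeasibleAt T S ω) (p : ℕ → ℝ) (β : ℝ) (N : ℕ) :
    ∑ t ∈ Finset.range (S N ω), (p (age T b Δ₀ S t ω) - β) =
      excess p β (sendAge b Δ₀ S N ω) - excess p β Δ₀ +
        ∑ i ∈ Finset.range N, excessDrop p β T b Δ₀ S i ω := by
  induction N with
  | zero => simp [h.zero, sendAge]
  | succ N ih =>
    obtain ⟨k, hk⟩ := Nat.exists_eq_add_of_le (h.feasible N)
    have hx : T N ω + b + k = sendAge b Δ₀ S (N + 1) ω := by simp only [sendAge]; omega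
    rw [hk, h.sum_range_idle p β hk.ge, ih, Finset.sum_range_succ, hx]
    ring

lemma exists_last_send (h : IsFeasibleAt T S ω) (n : ℕ) :
    ∃ N ≤ n, S N ω ≤ n ∧ n < S (N + 1) ω := by
  refine ⟨Nat.findGreatest (fun i => S i ω ≤ n) n, Nat.findGreatest_le n,
    Nat.findGreatest_spec (P := fun i => S i ω ≤ n) (Nat.zero_le n) (by simp [h.zero]), ?_⟩
  by_contra hcon
  push Not at hcon
  have h1 := Nat.le_findGreatest (P := fun i => S i ω ≤ n) ((h.le_send _).trans hcon) hcon
  omega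

lemma send_le_iff_of_last (h : IsFeasibleAt T S ω) {n N : ℕ} (h1 : S N ω ≤ n)
    (h2 : n < S (N + 1) ω) (i : ℕ) : S i ω ≤ n ↔ i ≤ N := by
  constructor
  · intro hi
    by_contra hcon
    have := h.strictMono.monotone (show N + 1 ≤ i by omega)
    omega
  · intro hi
    exact (h.strictMono.monotone hi).trans h1

/-- Indicators on a deterministic range replace the random number of terms, so that expectations can
be taken term by term. -/
lemma sum_ite_send_le (h : IsFeasibleAt T S ω) {n N : ℕ} (hN : N ≤ n) (h1 : S N ω ≤ n)
    (h2 : n < S (N + 1) ω) (f : ℕ → ℝ) :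
    ∑ i ∈ Finset.range (n + 1), (if S i ω ≤ n then f i else 0) =
      ∑ i ∈ Finset.range (N + 1), f i := by
  rw [← Finset.sum_filter]
  refine Finset.sum_congr ?_ fun _ _ => rfl
  ext i
  simp only [Finset.mem_filter, Finset.mem_range, h.send_le_iff_of_last h1 h2]
  omega

/-- The excess cost up to time `n` is the sum of the drops of the features sent by then, up to
the current excess or an error of the order of one transmission time. -/
lemma sum_range_eq (h : IsFeasibleAt T S ω) {p : ℕ → ℝ} {M : ℝ} (hp : ∀ δ, |p δ| ≤ M) (β : ℝ)
    {n N : ℕ} (hN : N ≤ n) (h1 : S N ω ≤ n) (h2 : n < S (N + 1) ω) :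
    ∃ e : ℝ, ∑ t ∈ Finset.range n, (p (age T b Δ₀ S t ω) - β) = e - excess p β Δ₀ +
        ∑ i ∈ Finset.range (n + 1), (if S i ω ≤ n then excessDrop p β T b Δ₀ S i ω else 0) ∧
      (e = excess p β (n - S N ω + b) ∨ |e| ≤ (M + |β|) * (2 * T N ω + b)) := by
  rw [h.sum_ite_send_le hN h1 h2, Finset.sum_range_succ]
  obtain ⟨k, rfl⟩ := Nat.exists_eq_add_of_le h1
  by_cases hk : T N ω ≤ k
  · obtain ⟨j, rfl⟩ := Nat.exists_eq_add_of_le hk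
    refine ⟨_, ?_, Or.inl rfl⟩
    rw [← add_assoc, h.sum_range_idle p β (by omega), h.sum_range_send,
      show S N ω + T N ω + j - S N ω + b = T N ω + b + j by omega]
    ring
  -- Feature `N` is still in transmission, but its drop is already counted; `e` takes it back. One
  -- `T N` bounds the remaining transmission, the other comes from `excess` at `T N + b`.
  · refine ⟨excess p β (sendAge b Δ₀ S N ω + k) - excess p β (sendAge b Δ₀ S N ω + T N ω) +
      excess p β (T N ω + b), ?_, Or.inr ?_⟩
    · rw [h.sum_range_delivery p β (by omega), h.sum_range_send, excessDrop]
      ring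
    · obtain ⟨j, hj⟩ := Nat.exists_eq_add_of_le (show k ≤ T N ω by omega)
      have e1 := abs_excess_add_sub_le hp β (sendAge b Δ₀ S N ω + k) j
      have e2 := abs_excess_le hp β (T N ω + b)
      rw [add_assoc, ← hj] at e1
      have e3 : (M + |β|) * j ≤ (M + |β|) * T N ω :=
        mul_le_mul_of_nonneg_left (by exact_mod_cast (by omega : j ≤ T N ω))
          (lipschitz_nonneg hp β)
      push_cast at e2
      rw [abs_le] at *
      constructor <;> linarith

lemma cycleLength_eq (w : ℕ) {i : ℕ} (hw : S (i + 1) ω = S i ω + T i ω + w) :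
    cycleLength T S i ω = w + T (i + 1) ω := by
  simp only [cycleLength, delivery, hw]; push_cast; ring

lemma cycleCost_eq (h : IsFeasibleAt T S ω) (p : ℕ → ℝ) {w : ℕ} {i : ℕ}
    (hw : S (i + 1) ω = S i ω + T i ω + w) :
    cycleCost p T b Δ₀ S i ω =
      ∑ k ∈ Finset.range (w + T (i + 1) ω), p (T i ω + b + k) := by
  rw [cycleCost, Finset.sum_Ico_eq_sum_range]
  have hlen : delivery T S (i + 1) ω - delivery T S i ω = w + T (i + 1) ω := by
    simp only [delivery, hw]; omega
  rw [hlen]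
  refine Finset.sum_congr rfl fun k hk => ?_
  rw [delivery, h.age_idle (by have := Finset.mem_range.1 hk; omega)]

end IsFeasibleAt

/-- The least age of a delivered feature is at most `k` exactly when some delivered feature has age
at most `k`, a countable union of events. -/
lemma measurable_age [MeasurableSpace Ω] {T S : ℕ → Ω → ℕ} (hT : ∀ i, Measurable (T i))
    (hS : ∀ i, Measurable (S i)) (b Δ₀ t : ℕ) : Measurable (age T b Δ₀ S t) := by
  have hD : ∀ i, MeasurableSet {ω | delivery T S i ω ≤ t} := fun i =>
    ((hS i).add (hT i)) (MeasurableSet.of_discrete (s := Set.Iic t))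
  refine measurable_of_Iic fun k => ?_
  have : age T b Δ₀ S t ⁻¹' Set.Iic k =
      (⋃ i, {ω | delivery T S i ω ≤ t} ∩ {ω | t - S i ω + b ≤ k}) ∪
        ((⋃ i, {ω | delivery T S i ω ≤ t})ᶜ ∩ {_ω | Δ₀ + t ≤ k}) := by
    ext ω
    simp only [Set.mem_preimage, Set.mem_Iic, Set.mem_union, Set.mem_iUnion, Set.mem_inter_iff,
      Set.mem_ofPred_eq, Set.mem_compl_iff, age]
    split_ifs with hex
    · simp only [hex, not_true_eq_false, false_and, or_false]
      constructor
      · intro hle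
        obtain ⟨i, hi, he⟩ := Nat.sInf_mem (s := {a : ℕ | ∃ i, delivery T S i ω ≤ t ∧
          a = t - S i ω + b}) (by obtain ⟨i, hi⟩ := hex; exact ⟨_, i, hi, rfl⟩)
        exact ⟨i, hi, he ▸ hle⟩
      · rintro ⟨i, hi, hk⟩
        have hmem : t - S i ω + b ∈ {a : ℕ | ∃ i, delivery T S i ω ≤ t ∧ a = t - S i ω + b} :=
          ⟨i, hi, rfl⟩
        exact (Nat.sInf_le hmem).trans hk
    · simp only [hex, not_false_eq_true, true_and]
      constructor
      · exact Or.inr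
      · rintro (⟨i, hi, -⟩ | hk)
        · exact absurd ⟨i, hi⟩ hex
        · exact hk
  rw [this]
  refine (MeasurableSet.iUnion fun i => (hD i).inter ?_).union
    ((MeasurableSet.iUnion hD).compl.inter (MeasurableSet.const _))
  exact (hS i) (MeasurableSet.of_discrete (s := {s | t - s + b ≤ k}))

end BufferScheduling

/-! ### The one-cycle problem: minimising cost over length among waiting rules -/

namespace BufferScheduling

variable {Ω : Type*} [MeasurableSpace Ω]

/-- The expected cost of an inter-delivery interval in excess of `β` times its length, under the
waiting rule `w`; see `IsModel.integral_cycle`. -/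
noncomputable def waitGain (μ : Measure Ω) (p : ℕ → ℝ) (T : ℕ → Ω → ℕ) (b : ℕ) (β : ℝ)
    (w : ℕ → ℕ) : ℝ :=
  (∫ ω, meanExcess μ p T β (T 0 ω + b + w (T 0 ω + b)) ∂μ) - ∫ ω, excess p β (T 0 ω + b) ∂μ

/-- The expected length of an inter-delivery interval under the waiting rule `w`. -/
noncomputable def waitLength (μ : Measure Ω) (T : ℕ → Ω → ℕ) (b : ℕ) (w : ℕ → ℕ) : ℝ :=
  ∫ ω, ((w (T 0 ω + b) : ℝ) + (T 1 ω : ℝ)) ∂μ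

/-- The expected cost of an inter-delivery interval under the waiting rule `w`. -/
noncomputable def waitCost (μ : Measure Ω) (p : ℕ → ℝ) (T : ℕ → Ω → ℕ) (b : ℕ) (w : ℕ → ℕ) : ℝ :=
  ∫ ω, ∑ k ∈ Finset.range (w (T 0 ω + b) + T 1 ω), p (T 0 ω + b + k) ∂μ

/-- Waiting rules with finite mean. -/
def IsIntegrableRule (μ : Measure Ω) (T : ℕ → Ω → ℕ) (b : ℕ) (w : ℕ → ℕ) : Prop :=
  Integrable (fun ω => (w (T 0 ω + b) : ℝ)) μ

lemma sum_eq_excess_sub (p : ℕ → ℝ) (β : ℝ) (a n : ℕ) :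
    ∑ k ∈ Finset.range n, p (a + k) = excess p β (a + n) - excess p β a + β * n := by
  rw [excess_add, Finset.sum_sub_distrib]
  simp only [Finset.sum_const, Finset.card_range, nsmul_eq_mul]
  ring

lemma isBoundedUnder_average {p : ℕ → ℝ} {M : ℝ} (hp : ∀ δ, |p δ| ≤ M) :
    IsBoundedUnder (· ≥ ·) atTop
      (fun n : ℕ => (1 / (n : ℝ)) * ∑ δ ∈ Finset.range n, p δ) := by
  refine isBoundedUnder_of ⟨-M, fun n => ?_⟩
  have hM : 0 ≤ M := (abs_nonneg _).trans (hp 0)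
  rcases Nat.eq_zero_or_pos n with rfl | hn
  · simpa using hM
  have hn' : (0 : ℝ) < n := by exact_mod_cast hn
  have : (Finset.range n).card • (-M) ≤ ∑ δ ∈ Finset.range n, p δ :=
    Finset.card_nsmul_le_sum _ _ _ fun k _ => (abs_le.1 (hp k)).1
  simp only [Finset.card_range, nsmul_eq_mul] at this
  rw [ge_iff_le, one_div, inv_mul_eq_div, le_div_iff₀ hn']
  linarith

lemma exists_linear_le_excess {p : ℕ → ℝ} {M : ℝ} (hp : ∀ δ, |p δ| ≤ M) {β : ℝ}
    (hβ : β < staleCost p) : ∃ ε > 0, ∃ C, ∀ n : ℕ, ε * n - C ≤ excess p β n := by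
  obtain ⟨x, hx1, hx2⟩ := exists_between hβ
  have hev := eventually_lt_of_lt_liminf hx2 (isBoundedUnder_average hp)
  obtain ⟨n₀, hn₀⟩ := eventually_atTop.1 hev
  -- The slope is the margin of the eventual averages over β; the constant absorbs the ages below
  -- `n₀` through the linear bound on `excess`.
  refine ⟨x - β, sub_pos.2 hx1, (M + |β| + (x - β)) * n₀, fun n => ?_⟩
  have hC := lipschitz_nonneg hp β
  have hn₀' : (0 : ℝ) ≤ n₀ := n₀.cast_nonneg
  have hx0 : 0 ≤ x - β := (sub_pos.2 hx1).le
  by_cases hn : n₀ ≤ n ∧ 0 < n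
  · have hn' : (0 : ℝ) < n := by exact_mod_cast hn.2
    have h1 := hn₀ n hn.1
    rw [one_div, inv_mul_eq_div, lt_div_iff₀ hn'] at h1
    rw [excess_eq_sum_sub]
    have : 0 ≤ (M + |β| + (x - β)) * n₀ := by positivity
    linarith
  · have hle : (n : ℝ) ≤ n₀ := by exact_mod_cast (by omega : n ≤ n₀)
    have h1 := (abs_le.1 (abs_excess_le hp β n)).1
    have h2 : (M + |β|) * n ≤ (M + |β|) * n₀ := by gcongr
    have h3 : (x - β) * n ≤ (x - β) * n₀ := by gcongr
    linarith

variable {μ : Measure Ω} [IsProbabilityMeasure μ]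
  {ℱ : Filtration ℕ (inferInstance : MeasurableSpace Ω)} {p : ℕ → ℝ} {M : ℝ} {T : ℕ → Ω → ℕ}
  {b : ℕ} {w : ℕ → ℕ}

namespace IsModel

lemma integrable_age (h : IsModel μ ℱ p M T) (b i : ℕ) :
    Integrable (fun ω => ((T i ω + b : ℕ) : ℝ)) μ := by
  simpa using (h.integrable_time i).add (integrable_const (b : ℝ))

lemma integrable_age_add_wait (h : IsModel μ ℱ p M T) (hw : IsIntegrableRule μ T b w) (i : ℕ) :
    Integrable (fun ω => ((T i ω + b + w (T i ω + b) : ℕ) : ℝ)) μ := by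
  have hw' := h.integrable_comp (f := fun t => (w (t + b) : ℝ)) hw i
  exact ((h.integrable_age b i).add hw').congr (Eventually.of_forall fun ω => by simp)

lemma measurable_comp (h : IsModel μ ℱ p M T) (f : ℕ → ℕ) (i : ℕ) :
    Measurable (fun ω => f (T i ω)) :=
  (Measurable.of_discrete (f := f)).comp (h.measurable i)

lemma integrable_meanExcess_wait (h : IsModel μ ℱ p M T) (hw : IsIntegrableRule μ T b w)
    (β : ℝ) (i : ℕ) :
    Integrable (fun ω => meanExcess μ p T β (T i ω + b + w (T i ω + b))) μ :=
  h.integrable_meanExcess β (h.measurable_comp (fun t => t + b + w (t + b)) i)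
    (h.integrable_age_add_wait hw i)

lemma integrable_excess_age (h : IsModel μ ℱ p M T) (β : ℝ) (b i : ℕ) :
    Integrable (fun ω => excess p β (T i ω + b)) μ :=
  integrable_excess h.bounded β (h.measurable_comp (fun t => t + b) i) (h.integrable_age b i)

lemma integrable_wait_add_time (h : IsModel μ ℱ p M T) (hw : IsIntegrableRule μ T b w) (i : ℕ) :
    Integrable (fun ω => (w (T i ω + b) : ℝ) + (T (i + 1) ω : ℝ)) μ :=
  (h.integrable_comp (f := fun t => (w (t + b) : ℝ)) hw i).add (h.integrable_time (i + 1))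

/-- The age at sending is known after delivery `i` and the next transmission time is independent of
it, so averaging over the latter turns `excess` into `meanExcess`. Identical laws remove the
dependence on `i`. -/
lemma integral_cycle (h : IsModel μ ℱ p M T) (hw : IsIntegrableRule μ T b w) (β : ℝ) (i : ℕ) :
    (∫ ω, ∑ k ∈ Finset.range (w (T i ω + b) + T (i + 1) ω), p (T i ω + b + k) ∂μ) -
      β * (∫ ω, ((w (T i ω + b) : ℝ) + (T (i + 1) ω : ℝ)) ∂μ) = waitGain μ p T b β w := by
  have hX : Measurable[ℱ i] (fun ω => T i ω + b + w (T i ω + b)) :=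
    (Measurable.of_discrete (f := fun t : ℕ => t + b + w (t + b))).comp (h.past i)
  have hQ : Integrable
      (fun ω => excess p β (T i ω + b + w (T i ω + b) + T (i + 1) ω)) μ := by
    refine integrable_excess h.bounded β
      ((hX.mono (ℱ.le i) le_rfl).add (h.measurable (i + 1))) ?_
    exact ((h.integrable_age_add_wait hw i).add (h.integrable_time (i + 1))).congr
      (Eventually.of_forall fun ω => by simp)
  have hL := h.integrable_wait_add_time hw i
  have hfr := h.integral_freeze i hX (fun x t => excess p β (x + t)) hQ
  have hQ0 := h.integrable_excess_age β b i
  have hsum : ∀ ω, ∑ k ∈ Finset.range (w (T i ω + b) + T (i + 1) ω), p (T i ω + b + k) =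
      excess p β (T i ω + b + w (T i ω + b) + T (i + 1) ω) - excess p β (T i ω + b) +
        β * ((w (T i ω + b) : ℝ) + (T (i + 1) ω : ℝ)) := fun ω => by
    rw [sum_eq_excess_sub p β, add_assoc (T i ω + b)]; push_cast; ring
  simp only [hsum]
  have hQQ : Integrable (fun ω => excess p β (T i ω + b + w (T i ω + b) + T (i + 1) ω) -
    excess p β (T i ω + b)) μ := hQ.sub hQ0
  rw [integral_add hQQ (hL.const_mul β), integral_const_mul,
    integral_sub hQ hQ0, add_sub_cancel_right, hfr, waitGain]
  congr 1
  · exact h.integral_comp (fun t => meanExcess μ p T β (t + b + w (t + b))) i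
  · exact h.integral_comp (fun t => excess p β (t + b)) i

lemma waitCost_sub (h : IsModel μ ℱ p M T) (hw : IsIntegrableRule μ T b w) (β : ℝ) :
    waitCost μ p T b w - β * waitLength μ T b w = waitGain μ p T b β w :=
  h.integral_cycle hw β 0

lemma waitGain_change (h : IsModel μ ℱ p M T) (hw : IsIntegrableRule μ T b w) (β β' : ℝ) :
    waitGain μ p T b β w = waitGain μ p T b β' w + (β' - β) * waitLength μ T b w := by
  rw [← h.waitCost_sub hw, ← h.waitCost_sub hw]; ring

lemma one_le_waitLength (h : IsModel μ ℱ p M T) (hw : IsIntegrableRule μ T b w) :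
    1 ≤ waitLength μ T b w := by
  have : ∫ _ω, (1 : ℝ) ∂μ ≤ waitLength μ T b w :=
    integral_mono (integrable_const _) (h.integrable_wait_add_time hw 0) fun ω => by
      have h1 : (1 : ℝ) ≤ T (0 + 1) ω := by exact_mod_cast h.pos 1 ω
      have h2 : (0 : ℝ) ≤ w (T 0 ω + b) := Nat.cast_nonneg _
      simp only
      linarith
  simpa using this

lemma waitGain_mono (h : IsModel μ ℱ p M T) {w w' : ℕ → ℕ} (hw : IsIntegrableRule μ T b w)
    (hw' : IsIntegrableRule μ T b w') {β : ℝ}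
    (hmin : ∀ᵐ ω ∂μ, ∀ k, meanExcess μ p T β (T 0 ω + b + w (T 0 ω + b)) ≤
      meanExcess μ p T β (T 0 ω + b + k)) :
    waitGain μ p T b β w ≤ waitGain μ p T b β w' := by
  refine sub_le_sub_right (integral_mono_ae (h.integrable_meanExcess_wait hw β 0)
    (h.integrable_meanExcess_wait hw' β 0) ?_) _
  filter_upwards [hmin] with ω hω using hω _

/-- A waiting rule that minimises the expected gain minimises it pointwise. -/
lemma minimum_of_optimal (h : IsModel μ ℱ p M T) (hw : IsIntegrableRule μ T b w) {β : ℝ}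
    (hopt : ∀ w', IsIntegrableRule μ T b w' → waitGain μ p T b β w ≤ waitGain μ p T b β w') :
    ∀ᵐ ω ∂μ, ∀ k, meanExcess μ p T β (T 0 ω + b + w (T 0 ω + b)) ≤
      meanExcess μ p T β (T 0 ω + b + k) := by
  have key : ∀ a k, ∀ᵐ ω ∂μ, T 0 ω + b = a →
      meanExcess μ p T β (a + w a) ≤ meanExcess μ p T β (a + k) := by
    intro a k
    by_contra hcon
    have hlt : meanExcess μ p T β (a + k) < meanExcess μ p T β (a + w a) := by
      by_contra! hle
      exact hcon (Eventually.of_forall fun _ _ => hle)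
    have hw' : IsIntegrableRule μ T b (Function.update w a k) := by
      refine Integrable.mono' (Integrable.add hw (integrable_const (k : ℝ)))
        (Measurable.aestronglyMeasurable
          ((Measurable.of_discrete (f := fun t => (Function.update w a k (t + b) : ℝ))).comp
            (h.measurable 0))) (Eventually.of_forall fun ω => ?_)
      rw [Real.norm_of_nonneg (Nat.cast_nonneg _)]
      simp only [Pi.add_apply, Function.update_apply]
      split_ifs
      · linarith [(Nat.cast_nonneg (w (T 0 ω + b)) : (0 : ℝ) ≤ _)]
      · linarith [(Nat.cast_nonneg k : (0 : ℝ) ≤ _)]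
    have hi := h.integrable_meanExcess_wait hw β 0
    have hi' := h.integrable_meanExcess_wait hw' β 0
    have hgain := hopt _ hw'
    simp only [waitGain] at hgain
    set f : Ω → ℝ := fun ω => meanExcess μ p T β (T 0 ω + b + w (T 0 ω + b)) -
      meanExcess μ p T β (T 0 ω + b + Function.update w a k (T 0 ω + b)) with hf
    have hf0 : 0 ≤ f := fun ω => by
      simp only [hf, Pi.zero_apply]
      by_cases hω : T 0 ω + b = a
      · rw [hω, Function.update_self]; linarith
      · rw [Function.update_of_ne hω]; simp
    have hfi : Integrable f μ := hi.sub hi'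
    have hint : ∫ ω, f ω ∂μ = 0 := by
      refine le_antisymm ?_ (integral_nonneg hf0)
      simp only [hf]
      rw [integral_sub hi hi']
      linarith
    have hae := (integral_eq_zero_iff_of_nonneg hf0 hfi).1 hint
    refine hcon ?_
    filter_upwards [hae] with ω hω ha
    simp only [hf, Pi.zero_apply, ha, Function.update_self] at hω
    linarith
  filter_upwards [ae_all_iff.2 fun a => ae_all_iff.2 fun k => key a k] with ω hω k
  exact hω _ k rfl

/-- Below the stale cost, optimal waiting times grow at most linearly in the age, locally
uniformly in `β`. -/
lemma exists_minimal_rules (h : IsModel μ ℱ p M T) (b : ℕ) {β : ℝ} (hβ : β < staleCost p) :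
    ∃ β₁ > β, ∃ L, ∀ β', β ≤ β' → β' ≤ β₁ → ∃ w, IsIntegrableRule μ T b w ∧
      waitLength μ T b w ≤ L ∧
      ∀ a k, meanExcess μ p T β' (a + w a) ≤ meanExcess μ p T β' (a + k) := by
  obtain ⟨β₁, h1, h2⟩ := exists_between hβ
  obtain ⟨ε, hε, C, hC⟩ := exists_linear_le_excess h.bounded h2
  set m := ∫ ω, (T 0 ω : ℝ) ∂μ with hm
  have hm0 : 0 ≤ m := integral_nonneg fun _ => Nat.cast_nonneg _
  set C₁ := C + (M + |β₁|) * m with hC₁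
  -- Dominates `M + |β'|` for every `β'` between `β` and `β₁`, which makes the bounds uniform.
  set K := M + (|β| + |β₁|) with hK
  have hMK : 0 ≤ K := by
    have := lipschitz_nonneg h.bounded β
    have := abs_nonneg β₁
    rw [hK]; linarith
  have hint : Integrable (fun ω => (C₁ + K * (((T 0 ω + b : ℕ) : ℝ) + m)) / ε) μ :=
    ((integrable_const _).add
      (((h.integrable_age b 0).add (integrable_const _)).const_mul _)).div_const _
  refine ⟨β₁, h1, ∫ ω, ((C₁ + K * (((T 0 ω + b : ℕ) : ℝ) + m)) / ε + T 1 ω) ∂μ,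
    fun β' hl hu => ?_⟩
  have hlow : ∀ n : ℕ, ε * n - C₁ ≤ meanExcess μ p T β' n := fun n => by
    have e1 := (abs_le.1 (h.abs_meanExcess_sub_excess_le β₁ n)).1
    have e2 := hC n
    rw [h.meanExcess_change β' β₁]
    have e3 : 0 ≤ (β₁ - β') * (n + m) :=
      mul_nonneg (sub_nonneg.2 hu) (add_nonneg (Nat.cast_nonneg _) hm0)
    rw [← hm] at e1 ⊢
    linarith
  have hex : ∀ a, ∃ k, ∀ j, meanExcess μ p T β' (a + k) ≤ meanExcess μ p T β' (a + j) := by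
    intro a
    have htend : Tendsto (fun k : ℕ => meanExcess μ p T β' (a + k)) cofinite atTop := by
      rw [Nat.cofinite_eq_atTop]
      have hlin : Tendsto (fun k : ℕ => ε * (k : ℝ) + -C₁) atTop atTop :=
        tendsto_atTop_add_const_right _ _ (tendsto_natCast_atTop_atTop.const_mul_atTop hε)
      refine tendsto_atTop_mono (fun k => ?_) hlin
      have e1 := hlow (a + k)
      have e2 : (0 : ℝ) ≤ ε * a := by positivity
      push_cast at e1
      linarith
    exact htend.exists_forall_le
  choose w hw using hex
  -- At the minimiser V is at most V(a), hence at most linear in `a`, while it is at least `ε (a + w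
  -- a) - C₁`.
  have hbound : ∀ a, (w a : ℝ) ≤ (C₁ + K * ((a : ℝ) + m)) / ε := fun a => by
    rw [le_div_iff₀ hε]
    have e1 := hlow (a + w a)
    have e2 := hw a 0
    have e3 := (abs_le.1 (h.abs_meanExcess_le β' a)).2
    rw [← hm] at e3
    have e4 : (M + |β'|) * (a + m) ≤ K * (a + m) := by
      refine mul_le_mul_of_nonneg_right ?_ (add_nonneg (Nat.cast_nonneg _) hm0)
      have : |β'| ≤ |β| + |β₁| := by
        rw [abs_le]
        constructor
        · linarith [neg_abs_le β, abs_nonneg β₁]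
        · linarith [le_abs_self β₁, abs_nonneg β]
      rw [hK]; linarith
    have e5 : (0 : ℝ) ≤ ε * a := by positivity
    rw [add_zero] at e2
    push_cast at e1
    linarith
  have hwi : IsIntegrableRule μ T b w := by
    refine hint.mono' ((Measurable.of_discrete (f := fun t => (w (t + b) : ℝ))).comp
      (h.measurable 0)).aestronglyMeasurable (Eventually.of_forall fun ω => ?_)
    rw [Real.norm_of_nonneg (Nat.cast_nonneg _)]
    exact hbound _
  refine ⟨w, hwi, ?_, hw⟩
  exact integral_mono (h.integrable_wait_add_time hwi 0) (hint.add (h.integrable_time 1))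
    fun ω => add_le_add (hbound _) le_rfl

/-- If sending is worthwhile, the optimal ratio of expected cost to expected length is attained
by a waiting rule. -/
lemma exists_optimal_rule (h : IsModel μ ℱ p M T) (hsend : SendingWorthwhile μ p T b) :
    ∃ β w, IsIntegrableRule μ T b w ∧ waitGain μ p T b β w = 0 ∧
      ∀ w', IsIntegrableRule μ T b w' → 0 ≤ waitGain μ p T b β w' := by
  obtain ⟨w₀, hw₀, hr⟩ := hsend
  set R : Set ℝ := (fun w => waitCost μ p T b w / waitLength μ T b w) ''
    {w | IsIntegrableRule μ T b w} with hR
  have hgain : ∀ {w}, IsIntegrableRule μ T b w → ∀ β, waitGain μ p T b β w =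
      (waitCost μ p T b w / waitLength μ T b w - β) * waitLength μ T b w := by
    intro w hw β
    have := h.one_le_waitLength hw
    rw [← h.waitCost_sub hw]
    field_simp
  have hbdd : BddBelow R := by
    refine ⟨-M, ?_⟩
    rintro _ ⟨w, hw, rfl⟩
    have hL := h.one_le_waitLength hw
    simp only
    rw [le_div_iff₀ (by linarith), waitLength, ← integral_const_mul]
    by_cases hc : Integrable (fun ω => ∑ k ∈ Finset.range (w (T 0 ω + b) + T 1 ω),
        p (T 0 ω + b + k)) μ
    · refine integral_mono ((h.integrable_wait_add_time hw 0).const_mul _) hc fun ω => ?_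
      have := Finset.card_nsmul_le_sum (Finset.range (w (T 0 ω + b) + T 1 ω))
        (fun k => p (T 0 ω + b + k)) (-M) fun k _ => (abs_le.1 (h.bounded _)).1
      simp only [Finset.card_range, nsmul_eq_mul, Nat.cast_add] at this
      simp only
      linarith
    -- In this case the integral takes the default value 0, which still respects the bound.
    · rw [waitCost, integral_undef hc, integral_const_mul]
      have hM : 0 ≤ M := (abs_nonneg _).trans (h.bounded 0)
      change -M * waitLength μ T b w ≤ 0
      nlinarith
  set β := sInf R with hβ
  have hle : ∀ w, IsIntegrableRule μ T b w → 0 ≤ waitGain μ p T b β w := fun w hw => by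
    rw [hgain hw]
    exact mul_nonneg (sub_nonneg.2 (csInf_le hbdd ⟨w, hw, rfl⟩))
      (zero_le_one.trans (h.one_le_waitLength hw))
  by_cases hst : β < staleCost p
  · obtain ⟨β₁, hβ₁, L, hL⟩ := h.exists_minimal_rules b hst
    obtain ⟨w, hw, -, hmin⟩ := hL β le_rfl hβ₁.le
    refine ⟨β, w, hw, le_antisymm ?_ (hle w hw), hle⟩
    -- A rule with ratio below `β + η` may be arbitrarily long. It is replaced by the minimal rule
    -- at level `β + η`, whose gain there is also nonpositive and whose length is at most `L`;
    -- returning to level `β` costs at most `η * L`.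
    have key : ∀ η, 0 < η → β + η ≤ β₁ → waitGain μ p T b β w ≤ η * L := by
      intro η hη hη₁
      obtain ⟨w₁, hw₁, hL₁, hmin₁⟩ := hL (β + η) (by linarith) hη₁
      obtain ⟨_, ⟨w₂, hw₂, rfl⟩, hlt⟩ := exists_lt_of_csInf_lt (s := R) ⟨_, w₀, hw₀, rfl⟩
        (show sInf R < β + η by linarith)
      have g2 : waitGain μ p T b (β + η) w₂ ≤ 0 := by
        rw [hgain hw₂]
        exact mul_nonpos_of_nonpos_of_nonneg (by simp only at hlt; linarith)
          (zero_le_one.trans (h.one_le_waitLength hw₂))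
      have g1 : waitGain μ p T b (β + η) w₁ ≤ waitGain μ p T b (β + η) w₂ :=
        h.waitGain_mono hw₁ hw₂ (Eventually.of_forall fun ω => hmin₁ _)
      have g3 := h.waitGain_change hw₁ β (β + η)
      have g4 : waitGain μ p T b β w ≤ waitGain μ p T b β w₁ :=
        h.waitGain_mono hw hw₁ (Eventually.of_forall fun ω => hmin _)
      have g5 : η * waitLength μ T b w₁ ≤ η * L := by gcongr
      have g6 : (β + η - β) * waitLength μ T b w₁ = η * waitLength μ T b w₁ := by ring
      linarith
    have hT : Tendsto (fun η : ℝ => η * L) (nhdsWithin 0 (Set.Ioi 0)) (nhds 0) := by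
      have : Tendsto (fun η : ℝ => η * L) (nhds 0) (nhds (0 * L)) :=
        (continuous_id.mul continuous_const).tendsto 0
      rw [zero_mul] at this
      exact this.mono_left nhdsWithin_le_nhds
    refine ge_of_tendsto hT ?_
    filter_upwards [Ioo_mem_nhdsGT (show (0 : ℝ) < β₁ - β by linarith)] with η hη
    exact key η hη.1 (by linarith [hη.2])
  -- Here the ratio of `w₀` is at most the stale cost, hence at most the infimum.
  · have h0 : waitCost μ p T b w₀ / waitLength μ T b w₀ = β :=
      le_antisymm (hr.trans (not_lt.1 hst)) (csInf_le hbdd ⟨w₀, hw₀, rfl⟩)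
    exact ⟨β, w₀, hw₀, by rw [hgain hw₀, h0]; ring, hle⟩

end IsModel

end BufferScheduling

/-! ### Expected drops and negligible end effects -/

namespace BufferScheduling

variable {Ω : Type*} [MeasurableSpace Ω]

/-- The largest of `Z_0, …, Z_n`. -/
def runningMax (Z : ℕ → Ω → ℕ) (n : ℕ) (ω : Ω) : ℕ := (Finset.range (n + 1)).sup fun i => Z i ω

lemma le_runningMax (Z : ℕ → Ω → ℕ) {i n : ℕ} (hi : i ≤ n) (ω : Ω) : Z i ω ≤ runningMax Z n ω :=
  Finset.le_sup (f := fun i => Z i ω) (Finset.mem_range.2 (by omega))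

lemma runningMax_le (Z : ℕ → Ω → ℕ) (n K : ℕ) (ω : Ω) :
    runningMax Z n ω ≤ K + ∑ i ∈ Finset.range (n + 1), (Z i ω - K) := by
  refine Finset.sup_le fun i hi => ?_
  have := Finset.single_le_sum (f := fun i => Z i ω - K) (fun _ _ => Nat.zero_le _) hi
  omega

lemma measurable_runningMax {Z : ℕ → Ω → ℕ} (hZ : ∀ i, Measurable (Z i)) (n : ℕ) :
    Measurable (runningMax Z n) := by
  induction n with
  | zero =>
    have : runningMax Z 0 = Z 0 := by ext ω; simp [runningMax]
    rw [this]; exact hZ 0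
  | succ n ih =>
    have : runningMax Z (n + 1) = fun ω => max (Z (n + 1) ω) (runningMax Z n ω) := by
      ext ω
      simp only [runningMax]
      rw [Finset.range_add_one (n := n + 1), Finset.sup_insert]
    rw [this]
    exact (hZ (n + 1)).max ih

/-- A waiting rule with zero gain that minimises the expected excess at the next delivery. -/
structure IsOptimalRule (μ : Measure Ω) (p : ℕ → ℝ) (T : ℕ → Ω → ℕ) (b : ℕ) (β : ℝ)
    (w : ℕ → ℕ) : Prop where
  integrable : IsIntegrableRule μ T b w
  gain_eq_zero : waitGain μ p T b β w = 0
  minimum : ∀ᵐ ω ∂μ, ∀ k, meanExcess μ p T β (T 0 ω + b + w (T 0 ω + b)) ≤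
      meanExcess μ p T β (T 0 ω + b + k)

/-- The time from the sending of feature `i` to the sending of the next one under the rule `w`. -/
def period (T : ℕ → Ω → ℕ) (b : ℕ) (w : ℕ → ℕ) (i : ℕ) (ω : Ω) : ℕ := T i ω + w (T i ω + b)

variable {μ : Measure Ω} [IsProbabilityMeasure μ]
  {ℱ : Filtration ℕ (inferInstance : MeasurableSpace Ω)} {p : ℕ → ℝ} {M : ℝ}
  {T S : ℕ → Ω → ℕ} {b : ℕ} {w : ℕ → ℕ} {β : ℝ} (Δ₀ : ℕ)

namespace IsCausal

lemma measurable_send (h : IsCausal μ ℱ T S) (i : ℕ) : Measurable[ℱ i] (S i) := by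
  cases i with
  | zero => rw [funext h.zero]; exact measurable_const
  | succ i => exact (h.adapted i).mono (ℱ.mono i.le_succ) le_rfl

lemma isFeasibleAt (h : IsCausal μ ℱ T S) (hM : IsModel μ ℱ p M T) :
    ∀ᵐ ω ∂μ, IsFeasibleAt T S ω := by
  filter_upwards [h.feasible] with ω hω using ⟨h.zero ω, fun i => hM.pos i ω, hω⟩

end IsCausal

namespace IsModel

lemma integrable_period (h : IsModel μ ℱ p M T) (hw : IsIntegrableRule μ T b w) (i : ℕ) :
    Integrable (fun ω => (period T b w i ω : ℝ)) μ :=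
  ((h.integrable_time i).add (h.integrable_comp (f := fun t => (w (t + b) : ℝ)) hw i)).congr
    (Eventually.of_forall fun ω => by simp [period])

lemma measurable_period (h : IsModel μ ℱ p M T) (b : ℕ) (w : ℕ → ℕ) (i : ℕ) :
    Measurable (period T b w i) :=
  h.measurable_comp (fun t => t + w (t + b)) i

lemma integrable_runningMax (h : IsModel μ ℱ p M T) (hw : IsIntegrableRule μ T b w) (n : ℕ) :
    Integrable (fun ω => (runningMax (period T b w) n ω : ℝ)) μ := by
  refine (integrable_finsetSum (Finset.range (n + 1)) fun i _ => h.integrable_period hw i).mono'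
    ((Measurable.of_discrete (f := fun k : ℕ => (k : ℝ))).comp
      (measurable_runningMax (h.measurable_period b w) n)).aestronglyMeasurable
    (Eventually.of_forall fun ω => ?_)
  rw [Real.norm_of_nonneg (Nat.cast_nonneg _)]
  have := runningMax_le (period T b w) n 0 ω
  simp only [zero_add, Nat.sub_zero] at this
  exact_mod_cast this

/-- By `runningMax_le` the mean maximum is at most K plus n + 1 times the mean overshoot above K.
The overshoot vanishes as K grows, so fixing K large and then letting n grow suffices; independence
plays no role. -/
lemma tendsto_integral_runningMax (h : IsModel μ ℱ p M T) (hw : IsIntegrableRule μ T b w) :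
    Tendsto (fun n : ℕ => (∫ ω, (runningMax (period T b w) n ω : ℝ) ∂μ) / n) atTop (nhds 0) := by
  have hmeas : ∀ K i, Measurable (fun ω => ((period T b w i ω - K : ℕ) : ℝ)) := fun K i =>
    (Measurable.of_discrete (f := fun k : ℕ => ((k - K : ℕ) : ℝ))).comp (h.measurable_period b w i)
  have hle : ∀ (K i : ℕ) ω, ‖((period T b w i ω - K : ℕ) : ℝ)‖ ≤ period T b w i ω :=
    fun K i ω => by
      rw [Real.norm_of_nonneg (Nat.cast_nonneg _)]
      exact_mod_cast Nat.sub_le _ _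
  have hint : ∀ K i, Integrable (fun ω => ((period T b w i ω - K : ℕ) : ℝ)) μ := fun K i =>
    (h.integrable_period hw i).mono' (hmeas K i).aestronglyMeasurable
      (Eventually.of_forall (hle K i))
  have htail : Tendsto (fun K : ℕ => ∫ ω, ((period T b w 0 ω - K : ℕ) : ℝ) ∂μ) atTop
      (nhds 0) := by
    have := tendsto_integral_of_dominated_convergence (μ := μ) (f := fun _ => (0 : ℝ))
      (F := fun K ω => ((period T b w 0 ω - K : ℕ) : ℝ)) (fun ω => (period T b w 0 ω : ℝ))
      (fun K => (hmeas K 0).aestronglyMeasurable) (h.integrable_period hw 0)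
      (fun K => Eventually.of_forall (hle K 0)) (Eventually.of_forall fun ω => by
        refine tendsto_const_nhds.congr' ?_
        filter_upwards [eventually_ge_atTop (period T b w 0 ω)] with K hK
        simp [Nat.sub_eq_zero_of_le hK])
    simpa using this
  have hbound : ∀ n K : ℕ, ∫ ω, (runningMax (period T b w) n ω : ℝ) ∂μ ≤
      K + (n + 1) * ∫ ω, ((period T b w 0 ω - K : ℕ) : ℝ) ∂μ := fun n K => by
    have hs := integrable_finsetSum (Finset.range (n + 1)) fun i _ => hint K i
    calc ∫ ω, (runningMax (period T b w) n ω : ℝ) ∂μ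
        ≤ ∫ ω, ((K : ℝ) +
            ∑ i ∈ Finset.range (n + 1), ((period T b w i ω - K : ℕ) : ℝ)) ∂μ :=
          integral_mono (h.integrable_runningMax hw n) ((integrable_const _).add hs)
            fun ω => by
              have := runningMax_le (period T b w) n K ω
              simp only
              exact_mod_cast this
      _ = _ := by
          rw [integral_add (integrable_const _) hs,
            integral_finsetSum _ fun i _ => hint K i]
          have : ∀ i, ∫ ω, ((period T b w i ω - K : ℕ) : ℝ) ∂μ =
              ∫ ω, ((period T b w 0 ω - K : ℕ) : ℝ) ∂μ := fun i =>
            h.integral_comp (fun t => ((t + w (t + b) - K : ℕ) : ℝ)) i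
          simp [this]
  rw [tendsto_order]
  refine ⟨fun a ha => Eventually.of_forall fun n => ha.trans_le
    (div_nonneg (integral_nonneg fun _ => Nat.cast_nonneg _) (Nat.cast_nonneg _)), fun a ha => ?_⟩
  obtain ⟨K, hK⟩ := (htail.eventually (gt_mem_nhds (show (0 : ℝ) < a / 2 by linarith))).exists
  set ε := ∫ ω, ((period T b w 0 ω - K : ℕ) : ℝ) ∂μ
  have hlim : Tendsto (fun n : ℕ => ((K : ℝ) + ε) / n + ε) atTop (nhds (0 + ε)) :=
    (tendsto_const_div_atTop_nhds_zero_nat _).add_const ε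
  filter_upwards [hlim.eventually (gt_mem_nhds (show 0 + ε < a by linarith)),
    eventually_gt_atTop 0] with n hn hn0
  have hn' : (0 : ℝ) < n := by exact_mod_cast hn0
  refine lt_of_le_of_lt ?_ hn
  rw [div_le_iff₀ hn', add_mul, div_mul_cancel₀ _ hn'.ne']
  linarith [hbound n K]

lemma integrable_age_excess (h : IsModel μ ℱ p M T) (hS : IsCausal μ ℱ T S) (b Δ₀ : ℕ) (β : ℝ)
    (n : ℕ) :
    Integrable (fun ω => ∑ t ∈ Finset.range n, (p (age T b Δ₀ S t ω) - β)) μ :=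
  integrable_finsetSum _ fun t _ => (h.integrable_penalty (measurable_age h.measurable
    (fun i => (hS.measurable_send i).mono (ℱ.le i) le_rfl) b Δ₀ t)).sub (integrable_const β)

lemma integral_age_excess (h : IsModel μ ℱ p M T) (hS : IsCausal μ ℱ T S) (b Δ₀ : ℕ) (β : ℝ)
    (n : ℕ) :
    ∫ ω, ∑ t ∈ Finset.range n, p (age T b Δ₀ S t ω) ∂μ =
      (∫ ω, ∑ t ∈ Finset.range n, (p (age T b Δ₀ S t ω) - β) ∂μ) + n * β := by
  have hn : (n : ℝ) * β = ∫ _ω, (n : ℝ) * β ∂μ := by simp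
  rw [hn, ← integral_add (h.integrable_age_excess hS b Δ₀ β n) (integrable_const _)]
  refine integral_congr_ae (Eventually.of_forall fun ω => ?_)
  simp [Finset.sum_sub_distrib]

lemma integrable_drop_zero (h : IsModel μ ℱ p M T) (b Δ₀ : ℕ) (β : ℝ) (S : ℕ → Ω → ℕ) :
    Integrable (excessDrop p β T b Δ₀ S 0) μ :=
  (h.integrable_excess_add β Δ₀ 0).sub (h.integrable_excess_age β b 0)

lemma integral_drop_zero (h : IsModel μ ℱ p M T) (b Δ₀ : ℕ) (β : ℝ) (S : ℕ → Ω → ℕ) :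
    ∫ ω, excessDrop p β T b Δ₀ S 0 ω ∂μ =
      meanExcess μ p T β Δ₀ - ∫ ω, excess p β (T 0 ω + b) ∂μ :=
  integral_sub (h.integrable_excess_add β Δ₀ 0) (h.integrable_excess_age β b 0)

lemma measurable_sendAge_succ (hS : IsCausal μ ℱ T S) (b Δ₀ i : ℕ) :
    Measurable[ℱ i] (fun ω => (S (i + 1) ω, sendAge b Δ₀ S (i + 1) ω)) :=
  (Measurable.of_discrete (f := fun x : ℕ × ℕ => (x.1, x.1 - x.2 + b))).comp
    ((hS.adapted i).prodMk (hS.measurable_send i))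

/-- Both values of `excess` contain the same transmission time `t`, so their difference sees only
the time between sendings, which is at most `n`. -/
lemma abs_ite_drop_le (hp : ∀ δ, |p δ| ≤ M) (S : ℕ → Ω → ℕ) (β : ℝ) (b n i t : ℕ) (ω : Ω) :
    |if S (i + 1) ω ≤ n then
      excess p β (sendAge b Δ₀ S (i + 1) ω + t) - excess p β (t + b) else 0| ≤
      (M + |β|) * n := by
  have hC := lipschitz_nonneg hp β
  split_ifs with hn
  · have e := abs_excess_add_sub_le hp β (t + b) (S (i + 1) ω - S i ω)
    rw [show t + b + (S (i + 1) ω - S i ω) = sendAge b Δ₀ S (i + 1) ω + t by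
      simp only [sendAge]; omega] at e
    refine e.trans (mul_le_mul_of_nonneg_left ?_ hC)
    exact_mod_cast (by omega : S (i + 1) ω - S i ω ≤ n)
  · rw [abs_zero]; positivity

lemma integrable_drop_succ (h : IsModel μ ℱ p M T) (hS : IsCausal μ ℱ T S) (b : ℕ) (β : ℝ)
    (n i : ℕ) :
    Integrable (fun ω => if S (i + 1) ω ≤ n then excessDrop p β T b Δ₀ S (i + 1) ω else 0) μ := by
  have hm : Measurable
      (fun ω => ((S (i + 1) ω, sendAge b Δ₀ S (i + 1) ω), T (i + 1) ω)) :=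
    ((measurable_sendAge_succ hS b Δ₀ i).mono (ℱ.le i) le_rfl).prodMk (h.measurable (i + 1))
  refine Integrable.of_bound (Measurable.aestronglyMeasurable ((Measurable.of_discrete
    (f := fun x : (ℕ × ℕ) × ℕ => if x.1.1 ≤ n then
      excess p β (x.1.2 + x.2) - excess p β (x.2 + b) else 0)).comp hm)) ((M + |β|) * n)
    (Eventually.of_forall fun ω => ?_)
  exact abs_ite_drop_le Δ₀ h.bounded S β b n i (T (i + 1) ω) ω

/-- Sending time and age at sending are known after delivery `i`, while `T (i + 1)` is fresh. -/
lemma integral_drop_succ (h : IsModel μ ℱ p M T) (hS : IsCausal μ ℱ T S) (b : ℕ) (β : ℝ)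
    (n i : ℕ) :
    ∫ ω, (if S (i + 1) ω ≤ n then excessDrop p β T b Δ₀ S (i + 1) ω else 0) ∂μ =
      ∫ ω, (if S (i + 1) ω ≤ n then meanExcess μ p T β (sendAge b Δ₀ S (i + 1) ω) -
        ∫ ω', excess p β (T 0 ω' + b) ∂μ else 0) ∂μ := by
  refine (h.integral_freeze i (measurable_sendAge_succ hS b Δ₀ i)
    (fun x t => if x.1 ≤ n then excess p β (x.2 + t) - excess p β (t + b) else 0)
    (h.integrable_drop_succ Δ₀ hS b β n i)).trans ?_
  refine integral_congr_ae (Eventually.of_forall fun ω => ?_)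
  beta_reduce
  split_ifs
  · exact integral_sub (h.integrable_excess_add β _ 0) (h.integrable_excess_age β b 0)
  · simp

lemma integrable_mean_succ (h : IsModel μ ℱ p M T) (hS : IsCausal μ ℱ T S) (b : ℕ) (β κ : ℝ)
    (n i : ℕ) :
    Integrable (fun ω => if S (i + 1) ω ≤ n then
      meanExcess μ p T β (sendAge b Δ₀ S (i + 1) ω) - κ else 0) μ := by
  have hm := (measurable_sendAge_succ hS b Δ₀ i).mono (ℱ.le i) le_rfl
  have hC := lipschitz_nonneg h.bounded β
  have hT0 : 0 ≤ ∫ ω, (T 0 ω : ℝ) ∂μ := integral_nonneg fun _ => Nat.cast_nonneg _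
  refine Integrable.of_bound (Measurable.aestronglyMeasurable ((Measurable.of_discrete
    (f := fun x : ℕ × ℕ => if x.1 ≤ n then meanExcess μ p T β x.2 - κ else 0)).comp hm))
    ((M + |β|) * ((n + b : ℕ) + ∫ ω, (T 0 ω : ℝ) ∂μ) + |κ|)
    (Eventually.of_forall fun ω => ?_)
  rw [Real.norm_eq_abs]
  split_ifs with hn
  · refine (abs_sub _ _).trans (add_le_add_left ((h.abs_meanExcess_le β _).trans ?_) _)
    refine mul_le_mul_of_nonneg_left (add_le_add_left ?_ _) hC
    exact_mod_cast (by simp only [sendAge]; omega : sendAge b Δ₀ S (i + 1) ω ≤ n + b)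
  · rw [abs_zero]; positivity

end IsModel

namespace IsOptimalRule

lemma minimum_all (hr : IsOptimalRule μ p T b β w) (h : IsModel μ ℱ p M T) :
    ∀ᵐ ω ∂μ, ∀ i k, meanExcess μ p T β (T i ω + b + w (T i ω + b)) ≤
      meanExcess μ p T β (T i ω + b + k) :=
  ae_all_iff.2 fun i => h.ae_comp (P := fun t => ∀ k,
    meanExcess μ p T β (t + b + w (t + b)) ≤ meanExcess μ p T β (t + b + k)) hr.minimum i

/-- One attained minimum bounds `meanExcess` below from that age on, and `excess` stays within a
bounded distance of it; the finitely many smaller ages are covered by the linear bound. -/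
lemma exists_le_excess (hr : IsOptimalRule μ p T b β w) (h : IsModel μ ℱ p M T) :
    ∃ K, 0 ≤ K ∧ ∀ n, -K ≤ excess p β n := by
  obtain ⟨ω, hω⟩ := hr.minimum.exists
  set a := T 0 ω + b
  have hC := lipschitz_nonneg h.bounded β
  have hT0 : 0 ≤ ∫ ω, (T 0 ω : ℝ) ∂μ := integral_nonneg fun _ => Nat.cast_nonneg _
  refine ⟨|meanExcess μ p T β (a + w a)| + (M + |β|) * ∫ ω, (T 0 ω : ℝ) ∂μ + (M + |β|) * a,
    by positivity, fun n => ?_⟩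
  have h0 := abs_nonneg (meanExcess μ p T β (a + w a))
  have h1 : 0 ≤ (M + |β|) * ∫ ω, (T 0 ω : ℝ) ∂μ := by positivity
  have h2 : 0 ≤ (M + |β|) * a := by positivity
  by_cases hn : a ≤ n
  · obtain ⟨k, rfl⟩ := Nat.exists_eq_add_of_le hn
    have e1 := hω k
    have e2 := (abs_le.1 (h.abs_meanExcess_sub_excess_le β (a + k))).2
    have e3 := neg_abs_le (meanExcess μ p T β (a + w a))
    linarith
  · have e1 := (abs_le.1 (abs_excess_le h.bounded β n)).1
    have e2 : (M + |β|) * n ≤ (M + |β|) * a :=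
      mul_le_mul_of_nonneg_left (by exact_mod_cast (not_le.1 hn).le) hC
    linarith

lemma integral_minimum (hr : IsOptimalRule μ p T b β w) :
    ∫ ω, meanExcess μ p T β (T 0 ω + b + w (T 0 ω + b)) ∂μ = ∫ ω, excess p β (T 0 ω + b) ∂μ :=
  sub_eq_zero.1 hr.gain_eq_zero

lemma integrable_ite (hr : IsOptimalRule μ p T b β w) (h : IsModel μ ℱ p M T) (κ : ℝ) (i : ℕ)
    {A : Ω → Prop} [DecidablePred A] (hA : MeasurableSet {ω | A ω}) :
    Integrable (fun ω => if A ω then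
      meanExcess μ p T β (T i ω + b + w (T i ω + b)) - κ else 0) μ :=
  (((h.integrable_meanExcess_wait hr.integrable β i).sub (integrable_const κ)).indicator hA).congr
    (Eventually.of_forall fun ω => by simp [Set.indicator_apply])

lemma measurableSet_send_le (hS : IsCausal μ ℱ T S) (n i : ℕ) : MeasurableSet {ω | S i ω ≤ n} :=
  ((hS.measurable_send i).mono (ℱ.le i) le_rfl) (MeasurableSet.of_discrete (s := Set.Iic n))

/-- Whether feature `i` is sent by time `n` is independent of its transmission time. -/
lemma integral_ite_send (hr : IsOptimalRule μ p T b β w) (h : IsModel μ ℱ p M T)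
    (hS : IsCausal μ ℱ T S) (n i : ℕ) :
    ∫ ω, (if S i ω ≤ n then meanExcess μ p T β (T i ω + b + w (T i ω + b)) -
      ∫ ω', excess p β (T 0 ω' + b) ∂μ else 0) ∂μ = 0 := by
  have h0 : ∫ ω, (meanExcess μ p T β (T 0 ω + b + w (T 0 ω + b)) -
      ∫ ω', excess p β (T 0 ω' + b) ∂μ) ∂μ = 0 := by
    rw [integral_sub (h.integrable_meanExcess_wait hr.integrable β 0) (integrable_const _),
      hr.integral_minimum]
    simp
  cases i with
  | zero => simpa [hS.zero] using h0
  | succ i =>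
    refine (h.integral_freeze i (hS.adapted i) (fun s t => if s ≤ n then
      meanExcess μ p T β (t + b + w (t + b)) - ∫ ω', excess p β (T 0 ω' + b) ∂μ else 0)
      (hr.integrable_ite h _ (i + 1) (measurableSet_send_le hS n (i + 1)))).trans ?_
    refine integral_eq_zero_of_ae (Eventually.of_forall fun ω => ?_)
    simp only [Pi.zero_apply]
    split_ifs
    · exact h0
    · simp

lemma abs_minimum_sub_le (h : IsModel μ ℱ p M T) (κ : ℝ) {n i : ℕ} (hi : i ≤ n) (ω : Ω) :
    |meanExcess μ p T β (T i ω + b + w (T i ω + b)) - κ| ≤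
      ((M + |β|) * (b + ∫ ω, (T 0 ω : ℝ) ∂μ) + |κ|) +
        (M + |β|) * runningMax (period T b w) n ω := by
  have h1 := h.abs_meanExcess_le β (T i ω + b + w (T i ω + b))
  have h2 : ((T i ω + b + w (T i ω + b) : ℕ) : ℝ) ≤ b + runningMax (period T b w) n ω := by
    have := le_runningMax (period T b w) hi ω
    simp only [period] at this
    exact_mod_cast (by omega)
  have h3 := mul_le_mul_of_nonneg_left h2 (lipschitz_nonneg h.bounded β)
  have h4 := abs_sub (meanExcess μ p T β (T i ω + b + w (T i ω + b))) κ
  linarith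

/-- The event that feature `i + 1` is sent by time `n` depends on `T i`, but the same event for
feature `i` does not and gives mean zero. On a path the two events differ only for the last feature
sent by `n`, leaving a single term bounded by the largest period. -/
lemma abs_sum_integral_le (hr : IsOptimalRule μ p T b β w) (h : IsModel μ ℱ p M T)
    (hS : IsCausal μ ℱ T S) (n : ℕ) (κ : ℝ) (hκ : κ = ∫ ω, excess p β (T 0 ω + b) ∂μ) :
    |∑ i ∈ Finset.range n, ∫ ω, (if S (i + 1) ω ≤ n then
        meanExcess μ p T β (T i ω + b + w (T i ω + b)) - κ else 0) ∂μ| ≤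
      ((M + |β|) * (b + ∫ ω, (T 0 ω : ℝ) ∂μ) + |κ|) +
        (M + |β|) * ∫ ω, (runningMax (period T b w) n ω : ℝ) ∂μ := by
  have hA := measurableSet_send_le hS n
  have hmax := h.integrable_runningMax hr.integrable n
  have hC := lipschitz_nonneg h.bounded β
  have hT0 : 0 ≤ ∫ ω, (T 0 ω : ℝ) ∂μ := integral_nonneg fun _ => Nat.cast_nonneg _
  have hdiff : ∀ i, ∫ ω, (if S (i + 1) ω ≤ n then
        meanExcess μ p T β (T i ω + b + w (T i ω + b)) - κ else 0) ∂μ =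
      -∫ ω, ((if S i ω ≤ n then meanExcess μ p T β (T i ω + b + w (T i ω + b)) - κ else 0) -
        (if S (i + 1) ω ≤ n then
          meanExcess μ p T β (T i ω + b + w (T i ω + b)) - κ else 0)) ∂μ := fun i => by
    rw [integral_sub (hr.integrable_ite h κ i (hA i)) (hr.integrable_ite h κ i (hA (i + 1))), hκ,
      hr.integral_ite_send h hS]
    ring
  simp only [hdiff, Finset.sum_neg_distrib, abs_neg]
  have hint : ∀ i, Integrable (fun ω =>
      (if S i ω ≤ n then meanExcess μ p T β (T i ω + b + w (T i ω + b)) - κ else 0) -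
        (if S (i + 1) ω ≤ n then
          meanExcess μ p T β (T i ω + b + w (T i ω + b)) - κ else 0)) μ := fun i =>
    (hr.integrable_ite h κ i (hA i)).sub (hr.integrable_ite h κ i (hA (i + 1)))
  rw [← integral_finsetSum _ fun i _ => hint i]
  refine abs_integral_le_integral_abs.trans ?_
  have hb : Integrable (fun ω => ((M + |β|) * (b + ∫ ω, (T 0 ω : ℝ) ∂μ) + |κ|) +
      (M + |β|) * (runningMax (period T b w) n ω : ℝ)) μ :=
    (integrable_const _).add (hmax.const_mul _)
  refine (integral_mono_ae (integrable_finsetSum _ fun i _ => hint i).abs hb ?_).trans_eq ?_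
  · filter_upwards [hS.isFeasibleAt h] with ω hω
    obtain ⟨N, hN, h1, h2⟩ := hω.exists_last_send n
    have hterm : ∀ i, ((if S i ω ≤ n then
        meanExcess μ p T β (T i ω + b + w (T i ω + b)) - κ else 0) -
        (if S (i + 1) ω ≤ n then
          meanExcess μ p T β (T i ω + b + w (T i ω + b)) - κ else 0)) =
        if i = N then meanExcess μ p T β (T i ω + b + w (T i ω + b)) - κ else 0 := fun i => by
      simp only [hω.send_le_iff_of_last h1 h2]
      rcases lt_trichotomy i N with hi | rfl | hi
      · rw [if_pos hi.le, if_pos (by omega), if_neg hi.ne, sub_self]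
      · simp
      · rw [if_neg (by omega), if_neg (by omega), if_neg hi.ne', sub_self]
    simp only [hterm]
    rw [Finset.sum_ite_eq']
    split_ifs
    · exact abs_minimum_sub_le h κ hN ω
    · rw [abs_zero]; positivity
  · rw [integral_add (integrable_const _) (hmax.const_mul _), integral_const_mul]
    simp

lemma integrable_drops (h : IsModel μ ℱ p M T) (hS : IsCausal μ ℱ T S) (b : ℕ) (β : ℝ) (n : ℕ) :
    Integrable (fun ω => ∑ i ∈ Finset.range (n + 1),
      (if S i ω ≤ n then excessDrop p β T b Δ₀ S i ω else 0)) μ := by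
  refine integrable_finsetSum _ fun i _ => ?_
  cases i with
  | zero => simpa [hS.zero] using h.integrable_drop_zero b Δ₀ β S
  | succ i => exact h.integrable_drop_succ Δ₀ hS b β n i

lemma integral_drops (h : IsModel μ ℱ p M T) (hS : IsCausal μ ℱ T S) (b : ℕ) (β : ℝ) (n : ℕ)
    (κ : ℝ) (hκ : κ = ∫ ω, excess p β (T 0 ω + b) ∂μ) :
    ∫ ω, ∑ i ∈ Finset.range (n + 1),
      (if S i ω ≤ n then excessDrop p β T b Δ₀ S i ω else 0) ∂μ =
    (∑ i ∈ Finset.range n, ∫ ω, (if S (i + 1) ω ≤ n then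
      meanExcess μ p T β (sendAge b Δ₀ S (i + 1) ω) - κ else 0) ∂μ) +
      (meanExcess μ p T β Δ₀ - κ) := by
  simp only [Finset.sum_range_succ', hS.zero, Nat.zero_le, if_true]
  rw [integral_add (integrable_finsetSum _ fun i _ => h.integrable_drop_succ Δ₀ hS b β n i)
    (h.integrable_drop_zero b Δ₀ β S), integral_finsetSum _ fun i _ =>
    h.integrable_drop_succ Δ₀ hS b β n i, h.integral_drop_zero b Δ₀ β S, hκ]
  simp only [h.integral_drop_succ Δ₀ hS b β n]

end IsOptimalRule

end BufferScheduling

/-! ### Average cost of causal schedules, and the roots of the threshold equation -/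

namespace BufferScheduling

variable {Ω : Type*} [MeasurableSpace Ω]

variable {μ : Measure Ω} [IsProbabilityMeasure μ]
  {ℱ : Filtration ℕ (inferInstance : MeasurableSpace Ω)} {p : ℕ → ℝ} {M : ℝ}
  {T S : ℕ → Ω → ℕ} {b : ℕ} {w : ℕ → ℕ} {β : ℝ}

/-- The schedule `S` waits according to the rule `w`. -/
def Follows (μ : Measure Ω) (T S : ℕ → Ω → ℕ) (b : ℕ) (w : ℕ → ℕ) : Prop :=
  ∀ᵐ ω ∂μ, ∀ i, S (i + 1) ω = S i ω + T i ω + w (T i ω + b)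

namespace IsOptimalRule

lemma age_cost_lower_bound (hr : IsOptimalRule μ p T b β w) (h : IsModel μ ℱ p M T)
    (hS : IsCausal μ ℱ T S) (Δ₀ : ℕ) :
    ∃ c d : ℝ, ∀ n : ℕ, n * β - (c + d * ∫ ω, (runningMax (period T b w) n ω : ℝ) ∂μ) ≤
      ∫ ω, ∑ t ∈ Finset.range n, p (age T b Δ₀ S t ω) ∂μ := by
  obtain ⟨K, hK0, hK⟩ := hr.exists_le_excess h
  have hC := lipschitz_nonneg h.bounded β
  set C := M + |β| with hCdef
  obtain ⟨κ, hκ⟩ : ∃ κ, κ = ∫ ω, excess p β (T 0 ω + b) ∂μ := ⟨_, rfl⟩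
  set c₁ := C * (b + ∫ ω, (T 0 ω : ℝ) ∂μ) + |κ|
  -- Of the factor 3, two come from a transmission in progress at time `n` and one from
  -- `abs_sum_integral_le`.
  refine ⟨K + C * b + excess p β Δ₀ + c₁ - (meanExcess μ p T β Δ₀ - κ), 3 * C, fun n => ?_⟩
  have hmax := h.integrable_runningMax hr.integrable n
  have hdrops := integrable_drops Δ₀ h hS b β n
  have hpath : ∀ᵐ ω ∂μ, (-(K + C * b + excess p β Δ₀) +
      -(2 * C) * (runningMax (period T b w) n ω : ℝ)) + (∑ i ∈ Finset.range (n + 1),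
        (if S i ω ≤ n then excessDrop p β T b Δ₀ S i ω else 0)) ≤
      ∑ t ∈ Finset.range n, (p (age T b Δ₀ S t ω) - β) := by
    filter_upwards [hS.isFeasibleAt h] with ω hω
    obtain ⟨N, hN, h1, h2⟩ := hω.exists_last_send n
    obtain ⟨e, he, hcases⟩ := hω.sum_range_eq (b := b) (Δ₀ := Δ₀) h.bounded β hN h1 h2
    rw [he]
    have hCb : 0 ≤ C * b := by positivity
    have hTN : (T N ω : ℝ) ≤ runningMax (period T b w) n ω := by
      have := le_runningMax (period T b w) hN ω
      simp only [period] at this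
      exact_mod_cast (by omega)
    have hCT : C * T N ω ≤ C * runningMax (period T b w) n ω := by gcongr
    have hCT0 : 0 ≤ C * T N ω := by positivity
    have : -(K + C * b) - 2 * (C * runningMax (period T b w) n ω) ≤ e := by
      rcases hcases with rfl | habs
      · linarith [hK (n - S N ω + b)]
      · linarith [(abs_le.1 habs).1]
    linarith
  have hconst : Integrable (fun ω => -(K + C * b + excess p β Δ₀) +
      -(2 * C) * (runningMax (period T b w) n ω : ℝ)) μ :=
    (integrable_const _).add (hmax.const_mul _)
  have hmono := integral_mono_ae (hconst.add hdrops) (h.integrable_age_excess hS b Δ₀ β n) hpath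
  simp only [Pi.add_apply] at hmono
  rw [integral_add hconst hdrops, integral_add (integrable_const _) (hmax.const_mul _),
    integral_const_mul, integral_drops Δ₀ h hS b β n κ hκ] at hmono
  have hR := (abs_le.1 (hr.abs_sum_integral_le h hS n κ hκ)).1
  have hcmp : ∑ i ∈ Finset.range n, ∫ ω, (if S (i + 1) ω ≤ n then
        meanExcess μ p T β (T i ω + b + w (T i ω + b)) - κ else 0) ∂μ ≤
      ∑ i ∈ Finset.range n, ∫ ω, (if S (i + 1) ω ≤ n then
        meanExcess μ p T β (sendAge b Δ₀ S (i + 1) ω) - κ else 0) ∂μ := by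
    refine Finset.sum_le_sum fun i _ => integral_mono_ae
      (hr.integrable_ite h κ i (measurableSet_send_le hS n (i + 1)))
      (h.integrable_mean_succ Δ₀ hS b β κ n i) ?_
    filter_upwards [hS.isFeasibleAt h, hr.minimum_all h] with ω hω hmin
    split_ifs
    · obtain ⟨k, hk⟩ := Nat.exists_eq_add_of_le (hω.feasible i)
      have hx : sendAge b Δ₀ S (i + 1) ω = T i ω + b + k := by simp only [sendAge]; omega
      rw [hx]
      exact sub_le_sub_right (hmin i k) κ
    · exact le_rfl
  rw [h.integral_age_excess hS b Δ₀ β n]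
  simp only [integral_const, probReal_univ, one_smul] at hmono
  linarith

/-- Following the rule turns the comparison of drops into an equality, and the time since the last
sending is below one period, which bounds the boundary term from above. -/
lemma age_cost_upper_bound (hr : IsOptimalRule μ p T b β w) (h : IsModel μ ℱ p M T)
    (hS : IsCausal μ ℱ T S) (hfollow : Follows μ T S b w) (Δ₀ : ℕ) :
    ∃ c d : ℝ, ∀ n : ℕ, ∫ ω, ∑ t ∈ Finset.range n, p (age T b Δ₀ S t ω) ∂μ ≤
      n * β + (c + d * ∫ ω, (runningMax (period T b w) n ω : ℝ) ∂μ) := by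
  have hC := lipschitz_nonneg h.bounded β
  set C := M + |β| with hCdef
  obtain ⟨κ, hκ⟩ : ∃ κ, κ = ∫ ω, excess p β (T 0 ω + b) ∂μ := ⟨_, rfl⟩
  set c₁ := C * (b + ∫ ω, (T 0 ω : ℝ) ∂μ) + |κ|
  refine ⟨C * b - excess p β Δ₀ + c₁ + (meanExcess μ p T β Δ₀ - κ), 3 * C, fun n => ?_⟩
  have hmax := h.integrable_runningMax hr.integrable n
  have hdrops := integrable_drops Δ₀ h hS b β n
  have hpath : ∀ᵐ ω ∂μ, ∑ t ∈ Finset.range n, (p (age T b Δ₀ S t ω) - β) ≤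
      ((C * b - excess p β Δ₀) + (2 * C) * (runningMax (period T b w) n ω : ℝ)) +
      (∑ i ∈ Finset.range (n + 1),
        (if S i ω ≤ n then excessDrop p β T b Δ₀ S i ω else 0)) := by
    filter_upwards [hS.isFeasibleAt h, hfollow] with ω hω hfol
    obtain ⟨N, hN, h1, h2⟩ := hω.exists_last_send n
    obtain ⟨e, he, hcases⟩ := hω.sum_range_eq (b := b) (Δ₀ := Δ₀) h.bounded β hN h1 h2
    rw [he]
    have hmaxN := le_runningMax (period T b w) hN ω
    simp only [period] at hmaxN
    have hTN : (T N ω : ℝ) ≤ runningMax (period T b w) n ω := by exact_mod_cast (by omega)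
    have hCT : C * T N ω ≤ C * runningMax (period T b w) n ω := by gcongr
    have hCm : 0 ≤ C * runningMax (period T b w) n ω := by positivity
    have : e ≤ C * b + 2 * (C * runningMax (period T b w) n ω) := by
      rcases hcases with rfl | habs
      · have e1 := (abs_le.1 (abs_excess_le h.bounded β (n - S N ω + b))).2
        have e2 : ((n - S N ω + b : ℕ) : ℝ) ≤ runningMax (period T b w) n ω + b := by
          rw [hfol N] at h2
          exact_mod_cast (by omega)
        have e3 := mul_le_mul_of_nonneg_left e2 hC
        linarith
      · linarith [(abs_le.1 habs).2]
    linarith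
  have hconst : Integrable (fun ω => (C * b - excess p β Δ₀) +
      (2 * C) * (runningMax (period T b w) n ω : ℝ)) μ :=
    (integrable_const _).add (hmax.const_mul _)
  have hmono := integral_mono_ae (h.integrable_age_excess hS b Δ₀ β n) (hconst.add hdrops) hpath
  simp only [Pi.add_apply] at hmono
  rw [integral_add hconst hdrops, integral_add (integrable_const _) (hmax.const_mul _),
    integral_const_mul, integral_drops Δ₀ h hS b β n κ hκ] at hmono
  have hR := (abs_le.1 (hr.abs_sum_integral_le h hS n κ hκ)).2
  have hcmp : ∑ i ∈ Finset.range n, ∫ ω, (if S (i + 1) ω ≤ n then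
        meanExcess μ p T β (sendAge b Δ₀ S (i + 1) ω) - κ else 0) ∂μ =
      ∑ i ∈ Finset.range n, ∫ ω, (if S (i + 1) ω ≤ n then
        meanExcess μ p T β (T i ω + b + w (T i ω + b)) - κ else 0) ∂μ := by
    refine Finset.sum_congr rfl fun i _ => integral_congr_ae ?_
    filter_upwards [hfollow] with ω hfol
    have hx : sendAge b Δ₀ S (i + 1) ω = T i ω + b + w (T i ω + b) := by
      simp only [sendAge, hfol i]; omega
    rw [hx]
  rw [h.integral_age_excess hS b Δ₀ β n]
  simp only [integral_const, probReal_univ, one_smul] at hmono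
  linarith

lemma abs_average_cost_le (h : IsModel μ ℱ p M T) (b Δ₀ : ℕ) (S : ℕ → Ω → ℕ) (n : ℕ) :
    |(1 / (n : ℝ)) * ∫ ω, ∑ t ∈ Finset.range n, p (age T b Δ₀ S t ω) ∂μ| ≤ M := by
  have hM : 0 ≤ M := (abs_nonneg _).trans (h.bounded 0)
  rcases Nat.eq_zero_or_pos n with rfl | hn
  · simpa using hM
  have hn' : (0 : ℝ) < n := by exact_mod_cast hn
  rw [abs_mul, abs_of_pos (by positivity : (0 : ℝ) < 1 / n), one_div, inv_mul_eq_div,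
    div_le_iff₀ hn']
  have := norm_integral_le_of_norm_le_const (μ := μ)
    (f := fun ω => ∑ t ∈ Finset.range n, p (age T b Δ₀ S t ω)) (C := M * n)
    (Eventually.of_forall fun ω => by
      refine (norm_sum_le_of_le (Finset.range n) (f := fun t => p (age T b Δ₀ S t ω))
        (n := fun _ => M) fun t _ => h.bounded _).trans_eq ?_
      simp [mul_comm])
  simpa using this

lemma tendsto_error (hr : IsOptimalRule μ p T b β w) (h : IsModel μ ℱ p M T) (c d : ℝ) :
    Tendsto (fun n : ℕ => β + (c / n +
      d * ((∫ ω, (runningMax (period T b w) n ω : ℝ) ∂μ) / n))) atTop (nhds β) := by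
  have := ((tendsto_const_div_atTop_nhds_zero_nat c).add
    ((h.tendsto_integral_runningMax hr.integrable).const_mul d)).const_add β
  simpa using this

lemma le_avgCost (hr : IsOptimalRule μ p T b β w) (h : IsModel μ ℱ p M T)
    (hS : IsCausal μ ℱ T S) (Δ₀ : ℕ) : β ≤ avgCost μ p T b Δ₀ S := by
  obtain ⟨c, d, hcd⟩ := hr.age_cost_lower_bound h hS Δ₀
  have ht := hr.tendsto_error h (-c) (-d)
  rw [← ht.limsup_eq, avgCost]
  refine limsup_le_limsup ?_ ht.isCoboundedUnder_le
    (isBoundedUnder_of ⟨M, fun n => (abs_le.1 (abs_average_cost_le h b Δ₀ S n)).2⟩)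
  filter_upwards [eventually_gt_atTop 0] with n hn
  have hn' : (0 : ℝ) < n := by exact_mod_cast hn
  rw [one_div, inv_mul_eq_div, le_div_iff₀ hn']
  have := hcd n
  field_simp
  linarith

lemma avgCost_le (hr : IsOptimalRule μ p T b β w) (h : IsModel μ ℱ p M T)
    (hS : IsCausal μ ℱ T S) (hfollow : Follows μ T S b w) (Δ₀ : ℕ) :
    avgCost μ p T b Δ₀ S ≤ β := by
  obtain ⟨c, d, hcd⟩ := hr.age_cost_upper_bound h hS hfollow Δ₀
  have ht := hr.tendsto_error h c d
  rw [← ht.limsup_eq, avgCost]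
  refine limsup_le_limsup ?_ (isBoundedUnder_of (r := (· ≥ ·)) ⟨-M, fun n =>
    (abs_le.1 (abs_average_cost_le h b Δ₀ S n)).1⟩).isCoboundedUnder_le ht.isBoundedUnder_le
  filter_upwards [eventually_gt_atTop 0] with n hn
  have hn' : (0 : ℝ) < n := by exact_mod_cast hn
  rw [one_div, inv_mul_eq_div, div_le_iff₀ hn']
  have := hcd n
  field_simp
  linarith

end IsOptimalRule

lemma Follows.integral_cycle (hfollow : Follows μ T S b w) (h : IsModel μ ℱ p M T)
    (h0 : ∀ ω, S 0 ω = 0) (Δ₀ i : ℕ) :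
    (cycleLength T S i =ᵐ[μ] fun ω => (w (T i ω + b) : ℝ) + (T (i + 1) ω : ℝ)) ∧
    (∫ ω, cycleCost p T b Δ₀ S i ω ∂μ =
      ∫ ω, ∑ k ∈ Finset.range (w (T i ω + b) + T (i + 1) ω), p (T i ω + b + k) ∂μ) := by
  constructor
  · filter_upwards [hfollow] with ω hω using IsFeasibleAt.cycleLength_eq _ (hω i)
  · refine integral_congr_ae ?_
    filter_upwards [hfollow] with ω hω
    have hf : IsFeasibleAt T S ω := ⟨h0 ω, fun i => h.pos i ω, fun i => by rw [hω i]; omega⟩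
    exact hf.cycleCost_eq p (hω i)

lemma Follows.integrable_cycleLength (hfollow : Follows μ T S b w) (h : IsModel μ ℱ p M T)
    (h0 : ∀ ω, S 0 ω = 0) (i : ℕ) :
    Integrable (cycleLength T S i) μ ↔ IsIntegrableRule μ T b w := by
  rw [integrable_congr (hfollow.integral_cycle h h0 0 i).1]
  constructor
  · intro hi
    have hi' : Integrable (fun ω => (w (T i ω + b) : ℝ)) μ :=
      (hi.sub (h.integrable_time (i + 1))).congr (Eventually.of_forall fun ω => by simp)
    exact (h.identComp (fun t => (w (t + b) : ℝ)) i).integrable_iff.1 hi'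
  · exact fun hw => h.integrable_wait_add_time hw i

lemma Follows.integral_cycleLength (hfollow : Follows μ T S b w) (h : IsModel μ ℱ p M T)
    (h0 : ∀ ω, S 0 ω = 0) (hw : IsIntegrableRule μ T b w) (i : ℕ) :
    1 ≤ ∫ ω, cycleLength T S i ω ∂μ := by
  rw [integral_congr_ae (hfollow.integral_cycle h h0 0 i).1]
  have : ∫ _ω, (1 : ℝ) ∂μ ≤ ∫ ω, ((w (T i ω + b) : ℝ) + (T (i + 1) ω : ℝ)) ∂μ :=
    integral_mono (integrable_const _) (h.integrable_wait_add_time hw i) fun ω => by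
      have h1 : (1 : ℝ) ≤ T (i + 1) ω := by exact_mod_cast h.pos (i + 1) ω
      have h2 : (0 : ℝ) ≤ w (T i ω + b) := Nat.cast_nonneg _
      simp only
      linarith
  simpa using this

lemma Follows.gain_eq (hfollow : Follows μ T S b w) (h : IsModel μ ℱ p M T)
    (h0 : ∀ ω, S 0 ω = 0) (hw : IsIntegrableRule μ T b w) (β : ℝ) (Δ₀ i : ℕ) :
    (∫ ω, cycleCost p T b Δ₀ S i ω ∂μ) - β * (∫ ω, cycleLength T S i ω ∂μ) =
      waitGain μ p T b β w := by
  obtain ⟨h1, h2⟩ := hfollow.integral_cycle h h0 Δ₀ i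
  rw [h2, integral_congr_ae h1]
  exact h.integral_cycle hw β i

/-- The test depends on `t` only through the time since the last sending, so the schedule is a
stationary waiting rule. The hypothesis excludes the infimum of the empty set, which would be 0. -/
lemma thresholdSend_succ {μ : Measure Ω} {p : ℕ → ℝ} {T : ℕ → Ω → ℕ} {b : ℕ} {β : ℝ} {i : ℕ}
    {ω : Ω} (hex : ∃ k, β ≤ gammaIndex μ p T (T i ω + b + k)) :
    thresholdSend μ p T b β (i + 1) ω =
      thresholdSend μ p T b β i ω + T i ω + indexWait μ p T β (T i ω + b) := by
  have hshift : ∀ k, thresholdSend μ p T b β i ω + T i ω + k - thresholdSend μ p T b β i ω + b =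
      T i ω + b + k := fun k => by omega
  rw [thresholdSend]
  apply le_antisymm
  · refine Nat.sInf_le ⟨by omega, ?_⟩
    rw [hshift]
    exact Nat.sInf_mem hex
  · refine le_csInf ?_ ?_
    · obtain ⟨k, hk⟩ := hex
      exact ⟨thresholdSend μ p T b β i ω + T i ω + k, by omega, by rwa [hshift]⟩
    · rintro t ⟨ht, hγ⟩
      obtain ⟨k, rfl⟩ := Nat.exists_eq_add_of_le ht
      rw [hshift] at hγ
      have : indexWait μ p T β (T i ω + b) ≤ k := Nat.sInf_le hγ
      omega

lemma thresholdWellDefined_iff :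
    ThresholdWellDefined μ p T b β ↔
      ∀ᵐ ω ∂μ, ∀ i, ∃ k, β ≤ gammaIndex μ p T (T i ω + b + k) := by
  have hshift : ∀ s t k : ℕ, s + t + k - s + b = t + b + k := fun s t k => by omega
  refine eventually_congr (Eventually.of_forall fun ω => forall_congr' fun i => ?_)
  constructor
  · rintro ⟨t, ht, hγ⟩
    obtain ⟨k, rfl⟩ := Nat.exists_eq_add_of_le ht
    exact ⟨k, by rwa [hshift] at hγ⟩
  · rintro ⟨k, hk⟩
    exact ⟨thresholdSend μ p T b β i ω + T i ω + k, by omega, by rwa [hshift]⟩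

lemma ThresholdWellDefined.follows (hwd : ThresholdWellDefined μ p T b β) :
    Follows μ T (thresholdSend μ p T b β) b (indexWait μ p T β) := by
  filter_upwards [thresholdWellDefined_iff.1 hwd] with ω hω i using thresholdSend_succ (hω i)

lemma ThresholdWellDefined.isCausal (hwd : ThresholdWellDefined μ p T b β)
    (h : IsModel μ ℱ p M T) : IsCausal μ ℱ T (thresholdSend μ p T b β) where
  zero _ := rfl
  -- The default value of the infimum makes this hold on every path, including those where the
  -- minimum does not exist.
  adapted := by
    have hstep : ∀ i, Measurable[ℱ i] (thresholdSend μ p T b β i) →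
        Measurable[ℱ i] (thresholdSend μ p T b β (i + 1)) := fun i hi =>
      (Measurable.of_discrete (f := fun x : ℕ × ℕ =>
        sInf {t : ℕ | x.1 + x.2 ≤ t ∧ β ≤ gammaIndex μ p T (t - x.1 + b)})).comp
        (hi.prodMk (h.past i))
    intro i
    induction i with
    | zero => exact hstep 0 measurable_const
    | succ i ih => exact hstep (i + 1) (ih.mono (ℱ.mono i.le_succ) le_rfl)
  feasible := by
    filter_upwards [hwd.follows] with ω hω i
    rw [hω i, delivery]
    omega

lemma ThresholdWellDefined.minimum (hwd : ThresholdWellDefined μ p T b β)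
    (h : IsModel μ ℱ p M T) :
    ∀ᵐ ω ∂μ, ∀ k, meanExcess μ p T β (T 0 ω + b + indexWait μ p T β (T 0 ω + b)) ≤
      meanExcess μ p T β (T 0 ω + b + k) := by
  filter_upwards [thresholdWellDefined_iff.1 hwd] with ω hω k
  exact h.meanExcess_indexWait_le (hω 0) k

lemma IsThresholdRoot.isOptimalRule {Δ₀ i : ℕ} (hroot : IsThresholdRoot μ p T b Δ₀ i β)
    (h : IsModel μ ℱ p M T) : IsOptimalRule μ p T b β (indexWait μ p T β) := by
  have hf := hroot.wellDefined.follows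
  have hw := (hf.integrable_cycleLength h (fun _ => rfl) i).1 hroot.integrable
  exact ⟨hw, by rw [← hf.gain_eq h (fun _ => rfl) hw β Δ₀ i]; exact hroot.equation,
    hroot.wellDefined.minimum h⟩

/-- At level `β` the rule `w` has gain zero and is minimal, whereas `w'` has gain `β' - β` times its
length, and that length is at least 1. Applied both ways, this gives uniqueness of the root. -/
lemma IsOptimalRule.threshold_le {β' : ℝ} {w' : ℕ → ℕ} (hr : IsOptimalRule μ p T b β w)
    (hr' : IsOptimalRule μ p T b β' w') (h : IsModel μ ℱ p M T) : β ≤ β' := by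
  have h1 := h.waitGain_mono hr.integrable hr'.integrable hr.minimum
  rw [hr.gain_eq_zero, h.waitGain_change hr'.integrable β β', hr'.gain_eq_zero, zero_add] at h1
  have h2 := h.one_le_waitLength hr'.integrable
  by_contra! hlt
  nlinarith

/-- An optimal waiting rule makes its threshold a root. -/
lemma IsOptimalRule.isThresholdRoot (hr : IsOptimalRule μ p T b β w) (h : IsModel μ ℱ p M T)
    (Δ₀ i : ℕ) : IsThresholdRoot μ p T b Δ₀ i β := by
  have hwd : ThresholdWellDefined μ p T b β := by
    rw [thresholdWellDefined_iff]
    filter_upwards [hr.minimum_all h] with ω hω i using (h.indexWait_of_minimum (hω i)).1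
  -- The index rule stops at the first minimiser, so it waits no longer than `w`.
  have hint : IsIntegrableRule μ T b (indexWait μ p T β) := by
    refine Integrable.mono' hr.integrable
      ((Measurable.of_discrete (f := fun t => (indexWait μ p T β (t + b) : ℝ))).comp
        (h.measurable 0)).aestronglyMeasurable ?_
    filter_upwards [hr.minimum] with ω hω
    rw [Real.norm_of_nonneg (Nat.cast_nonneg _)]
    exact_mod_cast (h.indexWait_of_minimum hω).2
  have hf := hwd.follows
  refine ⟨hwd, (hf.integrable_cycleLength h (fun _ => rfl) i).2 hint, ?_⟩
  rw [hf.gain_eq h (fun _ => rfl) hint β Δ₀ i, ← hr.gain_eq_zero]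
  exact le_antisymm (h.waitGain_mono hint hr.integrable (hwd.minimum h))
    (h.waitGain_mono hr.integrable hint hr.minimum)

end BufferScheduling

theorem theorem4 {Ω : Type*} [MeasurableSpace Ω] (μ : Measure Ω) [IsProbabilityMeasure μ]
    -- bounded penalty
    (p : ℕ → ℝ) (M : ℝ) (hp : ∀ δ, |p δ| ≤ M)
    -- i.i.d. transmission times with finite mean
    (T : ℕ → Ω → ℕ) (hT_pos : ∀ i ω, 1 ≤ T i ω)
    (hT_indep : iIndepFun T μ) (hT_ident : ∀ i, IdentDistrib (T i) (T 0) μ μ)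
    (hT_int : Integrable (fun ω => (T 0 ω : ℝ)) μ)
    -- information of the scheduler: it knows past transmission times, not future ones
    (ℱ : Filtration ℕ (inferInstance : MeasurableSpace Ω))
    (hℱ_past : ∀ i, Measurable[ℱ i] (T i))
    (hℱ_future : ∀ i, Indep (ℱ i) (MeasurableSpace.comap (T (i + 1)) inferInstance) μ)
    -- buffer position and initial age
    (b Δ₀ : ℕ)
    (hsend : BufferScheduling.SendingWorthwhile μ p T b) :
    ∃ β : ℝ,
      -- `β` is the unique root of the ratio equation, whichever `i` is used to write it
      (∀ i, BufferScheduling.IsThresholdRoot μ p T b Δ₀ i β ∧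
        ∀ β', BufferScheduling.IsThresholdRoot μ p T b Δ₀ i β' → β' = β) ∧
      -- the index-threshold schedule with threshold `β` is causal and optimal
      BufferScheduling.IsCausal μ ℱ T (BufferScheduling.thresholdSend μ p T b β) ∧
      (∀ S, BufferScheduling.IsCausal μ ℱ T S →
        BufferScheduling.avgCost μ p T b Δ₀ (BufferScheduling.thresholdSend μ p T b β) ≤
          BufferScheduling.avgCost μ p T b Δ₀ S) ∧
      BufferScheduling.avgCost μ p T b Δ₀ (BufferScheduling.thresholdSend μ p T b β) =
        BufferScheduling.optCost μ ℱ p T b Δ₀ ∧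
      -- the optimal value
      (∀ i, BufferScheduling.optCost μ ℱ p T b Δ₀ =
        (∫ ω, BufferScheduling.cycleCost p T b Δ₀
            (BufferScheduling.thresholdSend μ p T b β) i ω ∂μ) /
          (∫ ω, BufferScheduling.cycleLength T
            (BufferScheduling.thresholdSend μ p T b β) i ω ∂μ)) ∧
      β = BufferScheduling.optCost μ ℱ p T b Δ₀ := by
  have h : BufferScheduling.IsModel μ ℱ p M T :=
    ⟨hp, hT_pos, hT_ident, hT_int, hℱ_past, hℱ_future⟩
  obtain ⟨β, w, hw, hgain, hopt⟩ := h.exists_optimal_rule hsend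
  have hw_rule : BufferScheduling.IsOptimalRule μ p T b β w :=
    ⟨hw, hgain, h.minimum_of_optimal hw fun w' hw' => hgain.trans_le (hopt w' hw')⟩
  have hroot := hw_rule.isThresholdRoot h Δ₀
  have hwd := (hroot 0).wellDefined
  have hr := (hroot 0).isOptimalRule h
  have hcausal := hwd.isCausal h
  have hval : BufferScheduling.avgCost μ p T b Δ₀ (BufferScheduling.thresholdSend μ p T b β) = β :=
    le_antisymm (hr.avgCost_le h hcausal hwd.follows Δ₀) (hr.le_avgCost h hcausal Δ₀)
  have hoptCost : BufferScheduling.optCost μ ℱ p T b Δ₀ = β := by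
    have hleast : IsLeast (BufferScheduling.avgCost μ p T b Δ₀ ''
        {S | BufferScheduling.IsCausal μ ℱ T S}) β := by
      refine ⟨⟨_, hcausal, hval⟩, ?_⟩
      rintro _ ⟨S, hS, rfl⟩
      exact hr.le_avgCost h hS Δ₀
    exact hleast.csInf_eq
  refine ⟨β, fun i => ⟨hroot i, fun β' hβ' => ?_⟩, hcausal, fun S hS => ?_, ?_, fun i => ?_,
    hoptCost.symm⟩
  · have hr' := hβ'.isOptimalRule h
    exact le_antisymm (hr'.threshold_le hr h) (hr.threshold_le hr' h)
  · exact hval.trans_le (hr.le_avgCost h hS Δ₀)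
  · rw [hval, hoptCost]
  · have hlen := hwd.follows.integral_cycleLength h (fun _ => rfl) hr.integrable i
    rw [hoptCost, eq_div_iff (by linarith)]
    linarith [(hroot i).equation]
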